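/- Let $\Gamma_{1,1}$ be the fundamental group of the once-punctured torus. Realize the torus by gluing opposite sides of the ideal square in the hyperbolic plane with vertices $0,1,\infty,-1$: $\Gamma_{1,1}$ is free on the two side pairings $\gamma=\begin{pmatrix}2&1\\1&1\end{pmatrix}$ (carrying the side $(0,-1)$ to $(1,\infty)$) and $\delta=\begin{pmatrix}2&-1\\-1&1\end{pmatrix}$ (carrying the side $(0,1)$ to $(-1,\infty)$), and it acts by Möbius transformations on the set of cusps $\mathbb Q\cup\{\infty\}$. For flags $A=([a_1],\langle a_1,a_2\rangle)$, $B$, $C$, $D$ in $\mathbb R^3$ (with similar notation) put $$\tau(A,B,C)=\frac{a_1\wedge a_2\wedge b_1}{a_1\wedge a_2\wedge c_1}\cdot\frac{b_1\wedge b_2\wedge c_1}{b_1\wedge b_2\wedge a_1}\cdot\frac{c_1\wedge c_2\wedge a_1}{c_1\wedge c_2\wedge b_1},\qquad p(A,B,C,D)=\frac{a_1\wedge a_2\wedge d_1}{a_1\wedge a_2\wedge b_1}\cdot\frac{a_1\wedge c_1\wedge b_1}{a_1\wedge c_1\wedge d_1},$$ $$\sigma(A,B,C,D)=\bigl(\log(-p(A,B,C,D)),\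 \log(-p(C,B,A,D))\bigr)$$ (triple ratio, and shears along the edge $AC$). A quadruple $(A,B,C,D)$ is called positive if $\tau(A,B,C)$, $\tau(A,C,D)$, $-p(A,B,C,D)$ and $-p(C,B,A,D)$ are all defined and positive. A representation $\rho:\Gamma_{1,1}\to\mathrm{PSL}(3,\mathbb R)$ is positive if it has a positive framing, i.e. a $\rho$-equivariant map $\xi$ from $\mathbb Q\cup\{\infty\}$ to the full flags of $\mathbb R^3$ that sends every cyclically (counterclockwise) ordered quadruple of distinct cusps to a positive quadruple of flags. For $g\in\mathrm{PSL}(3,\mathbb R)=\mathrm{SL}(3,\mathbb R)$ with eigenvalues $|\lambda_1|\ge|\lambda_2|\ge|\lambda_3|$, counted with multiplicity, let $\ell_{\alpha_1}(g)=\log|\lambda_1/\lambda_2|$. **Theorem 1.7.** There is a continuous one-parameter family of positive representations $\rho_x:\Gamma_{1,1}\to\mathrm{PSL}(3,\mathbb R)$, $x\in(0,\infty)$ (that is, $x\mapsto\rho_x(g)$ is continuous for every $g$), with positive framings $\xi_x$ whose Fock–Goncharov coordinates with respect to the ideal triangulation of the torus given by the square and its diagonal $(0,\infty)$ are: triple ratios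 $$\tau(\xi_x(0),\xi_x(1),\xi_x(\infty))=x,\qquad \tau(\xi_x(\infty),\xi_x(-1),\xi_x(0))=x^{-1},$$ and all six shears zero, $$\sigma(\xi_x(\infty),\xi_x(-1),\xi_x(0),\xi_x(1))=\sigma(\xi_x(\infty),\xi_x(0),\xi_x(1),\xi_x(2))=\sigma(\xi_x(\infty),\xi_x(-2),\xi_x(-1),\xi_x(0))=(0,0),$$ such that $\ell_{\alpha_1}(\rho_x(\gamma))=\ell_{\alpha_1}(\rho_x(\delta))$ for all $x>0$, and $$\lim_{x\to0^+}\ell_{\alpha_1}(\rho_x(\gamma))=0.$$ -/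

import Mathlib

open Filter Topology
open scoped MatrixGroups

/-! ### The once-punctured torus -/

/-- The fundamental group `Γ_{1,1}` of the once-punctured torus: the free group on the two
side-pairing elements of the ideal square with vertices `0, 1, ∞, -1`. -/
abbrev Gamma11 : Type := FreeGroup (Fin 2)

namespace Gamma11

/-- The side pairing of the vertical sides. -/
def γ : Gamma11 := FreeGroup.of 0

/-- The side pairing of the horizontal sides. -/
def δ : Gamma11 := FreeGroup.of 1

/-- The side pairings of the ideal square in the hyperbolic plane with vertices `0, 1, ∞, -1`:
the first one maps the side `(0, -1)` to the side `(1, ∞)`, the second one maps the side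
`(0, 1)` to the side `(-1, ∞)`. -/
def sidePairing : Fin 2 → SL(2, ℤ) :=
  ![⟨!![2, 1; 1, 1], by simp [Matrix.det_fin_two_of]⟩,
    ⟨!![2, -1; -1, 1], by simp [Matrix.det_fin_two_of]⟩]

/-- The holonomy of the hyperbolic once-punctured torus obtained by gluing the sides of the ideal
square; it identifies `Γ_{1,1}` with the group of deck transformations of the universal cover. -/
def holonomy : Gamma11 →* SL(2, ℤ) := FreeGroup.lift sidePairing

end Gamma11

/-- The vertices of the lifted ideal triangulation (the lifts of the puncture to the circle at
infinity of the universal cover), which are all the points of `ℚ ∪ {∞}`. -/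
abbrev Cusp : Type := OnePoint ℚ

/-- The action of `Γ_{1,1}` on the cusps by deck (Möbius) transformations. -/
noncomputable def cuspAct (g : Gamma11) (c : Cusp) : Cusp :=
  Matrix.SpecialLinearGroup.mapGL ℚ (Gamma11.holonomy g) • c

/-- The linear order on the cusps that is the usual one on `ℚ` and has `∞` as largest element. -/
def Cusp.lt (a b : Cusp) : Prop :=
  OnePoint.elim a (⊤ : WithTop ℚ) (fun q : ℚ => (q : WithTop ℚ)) <
    OnePoint.elim b (⊤ : WithTop ℚ) (fun q : ℚ => (q : WithTop ℚ))

/-- `a, b, c, d` are distinct cusps in this cyclic (counterclockwise) order on the circle at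
infinity: some cyclic shift of the quadruple is increasing. -/
def Cusp.Cyclic (a b c d : Cusp) : Prop :=
  (Cusp.lt a b ∧ Cusp.lt b c ∧ Cusp.lt c d) ∨ (Cusp.lt b c ∧ Cusp.lt c d ∧ Cusp.lt d a) ∨
    (Cusp.lt c d ∧ Cusp.lt d a ∧ Cusp.lt a b) ∨ (Cusp.lt d a ∧ Cusp.lt a b ∧ Cusp.lt b c)

/-! ### Full flags in `ℝ³`, triple ratios and shears -/

/-- A full flag in `ℝ³`. -/
structure FullFlag where
  line : Submodule ℝ (Fin 3 → ℝ)
  plane : Submodule ℝ (Fin 3 → ℝ)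
  finrank_line : Module.finrank ℝ line = 1
  finrank_plane : Module.finrank ℝ plane = 2
  line_le_plane : line ≤ plane

/-- The identification of the third exterior power of `ℝ³` with `ℝ`: `u ∧ v ∧ w`. -/
noncomputable def wedge3 (u v w : Fin 3 → ℝ) : ℝ := Matrix.det (Matrix.of ![u, v, w])

namespace FullFlag

/-- `(u, v)` represents the flag `A = ([u], ⟨u, v⟩)`. -/
def IsFrame (A : FullFlag) (u v : Fin 3 → ℝ) : Prop :=
  A.line = Submodule.span ℝ {u} ∧ A.plane = Submodule.span ℝ {u, v}

theorem exists_isFrame (A : FullFlag) :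
    ∃ p : (Fin 3 → ℝ) × (Fin 3 → ℝ), A.IsFrame p.1 p.2 := by
  obtain ⟨u, hu, hul⟩ := finrank_eq_one_iff'.1 A.finrank_line
  have hline : A.line = Submodule.span ℝ {(u : Fin 3 → ℝ)} := by
    apply le_antisymm
    · intro w hw
      obtain ⟨c, hc⟩ := hul ⟨w, hw⟩
      exact Submodule.mem_span_singleton.2 ⟨c, congrArg Subtype.val hc⟩
    · rw [Submodule.span_singleton_le_iff_mem]; exact u.2
  have hlt : A.line < A.plane := by
    refine lt_of_le_of_ne A.line_le_plane fun h => ?_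
    have h1 := A.finrank_line
    rw [h, A.finrank_plane] at h1
    omega
  obtain ⟨v, hv, hvn⟩ := SetLike.exists_of_lt hlt
  refine ⟨(u, v), hline, (Submodule.eq_of_le_of_finrank_le ?_ ?_).symm⟩
  · rw [Submodule.span_le]
    rintro w (rfl | rfl)
    · exact A.line_le_plane u.2
    · exact hv
  · have h : A.line < Submodule.span ℝ {(u : Fin 3 → ℝ), v} := by
      refine lt_of_le_of_ne (hline.le.trans (Submodule.span_mono (by simp))) fun h => hvn ?_
      rw [h]
      exact Submodule.subset_span (by simp)
    have h2 := Submodule.finrank_lt_finrank_of_lt h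
    rw [A.finrank_line] at h2
    rw [A.finrank_plane]
    exact h2

/-- A vector spanning the line of the flag. -/
noncomputable def vec1 (A : FullFlag) : Fin 3 → ℝ := A.exists_isFrame.choose.1

/-- A vector that spans, together with `A.vec1`, the plane of the flag. -/
noncomputable def vec2 (A : FullFlag) : Fin 3 → ℝ := A.exists_isFrame.choose.2

theorem isFrame_vec (A : FullFlag) : A.IsFrame A.vec1 A.vec2 := A.exists_isFrame.choose_spec

/-- The triple ratio of three flags. -/
noncomputable def tripleRatio (A B C : FullFlag) : ℝ :=
  wedge3 A.vec1 A.vec2 B.vec1 / wedge3 A.vec1 A.vec2 C.vec1 *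
    (wedge3 B.vec1 B.vec2 C.vec1 / wedge3 B.vec1 B.vec2 A.vec1) *
    (wedge3 C.vec1 C.vec2 A.vec1 / wedge3 C.vec1 C.vec2 B.vec1)

/-- The projective cross ratio `pcr_{l_A}(A, l_B, l_D, l_C)` in the pencil `ℙ(ℝ³ / l_A)`, where
`pcr(x₁, x₂, x₃, x₄) = (x₁ ∧ x₃) (x₄ ∧ x₂) / ((x₁ ∧ x₂) (x₄ ∧ x₃))`, the first entry is the plane
of `A`, and the other three are the lines of `B`, `D` and `C`. -/
noncomputable def pcrAt (A B C D : FullFlag) : ℝ :=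
  wedge3 A.vec1 A.vec2 D.vec1 / wedge3 A.vec1 A.vec2 B.vec1 *
    (wedge3 A.vec1 C.vec1 B.vec1 / wedge3 A.vec1 C.vec1 D.vec1)

/-- The pair of shears `σ(A, l_B, C, l_D)` along the edge `AC` with opposite vertices `B`, `D`. -/
noncomputable def shear (A B C D : FullFlag) : ℝ × ℝ :=
  (Real.log (-pcrAt A B C D), Real.log (-pcrAt C B A D))

/-- A positive quadruple of flags: the Fock-Goncharov coordinates (two triple ratios and the
exponentials of two shears) of the quadrilateral `A, B, C, D`, triangulated by the diagonal `AC`,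
are positive. In particular no denominator in these coordinates vanishes. -/
def IsPositiveQuadruple (A B C D : FullFlag) : Prop :=
  0 < tripleRatio A B C ∧ 0 < tripleRatio A C D ∧ 0 < -pcrAt A B C D ∧ 0 < -pcrAt C B A D

theorem IsFrame.change {A : FullFlag} {u v u' v' : Fin 3 → ℝ} (h : A.IsFrame u v)
    (h' : A.IsFrame u' v') :
    ∃ a b c : ℝ, a ≠ 0 ∧ c ≠ 0 ∧ u' = a • u ∧ v' = b • u + c • v := by
  have hu' : u' ∈ Submodule.span ℝ {u} := by
    rw [← h.1, h'.1]; exact Submodule.mem_span_singleton_self u'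
  obtain ⟨a, ha⟩ := Submodule.mem_span_singleton.1 hu'
  have hv' : v' ∈ Submodule.span ℝ {u, v} := by
    rw [← h.2, h'.2]; exact Submodule.subset_span (by simp)
  obtain ⟨b, c, hbc⟩ := Submodule.mem_span_pair.1 hv'
  refine ⟨a, b, c, ?_, ?_, ha.symm, hbc.symm⟩
  · rintro rfl
    have h1 := A.finrank_line
    have h2 : A.line = ⊥ := by rw [h'.1, ← ha]; simp
    rw [h2, finrank_bot] at h1
    omega
  · rintro rfl
    have h1 := A.finrank_plane
    have h2 : A.plane = A.line := by
      refine le_antisymm ?_ A.line_le_plane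
      rw [h'.2, Submodule.span_le, h.1]
      rintro w (rfl | rfl)
      · exact hu'
      · exact Submodule.mem_span_singleton.2 ⟨b, by simpa using hbc⟩
    rw [h2, A.finrank_line] at h1
    omega

/-- The triple ratio does not depend on the choice of representatives. -/
theorem tripleRatio_eq {A B C : FullFlag} {a₁ a₂ b₁ b₂ c₁ c₂ : Fin 3 → ℝ} (hA : A.IsFrame a₁ a₂)
    (hB : B.IsFrame b₁ b₂) (hC : C.IsFrame c₁ c₂) :
    tripleRatio A B C = wedge3 a₁ a₂ b₁ / wedge3 a₁ a₂ c₁ * (wedge3 b₁ b₂ c₁ / wedge3 b₁ b₂ a₁) *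
      (wedge3 c₁ c₂ a₁ / wedge3 c₁ c₂ b₁) := by
  obtain ⟨p, q, r, hp, hr, h1, h2⟩ := hA.change A.isFrame_vec
  obtain ⟨p', q', r', hp', hr', h1', h2'⟩ := hB.change B.isFrame_vec
  obtain ⟨p'', q'', r'', hp'', hr'', h1'', h2''⟩ := hC.change C.isFrame_vec
  have key : ∀ (u v w : Fin 3 → ℝ) (s t k l : ℝ),
      wedge3 (s • u) (t • u + k • v) (l • w) = s * k * l * wedge3 u v w := by
    intro u v w s t k l
    simp [wedge3, Matrix.det_fin_three]
    ring
  rw [tripleRatio, h1, h2, h1', h2', h1'', h2'']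
  simp only [key]
  rw [mul_div_mul_comm, mul_div_mul_comm (p' * r' * p''), mul_div_mul_comm (p'' * r'' * p)]
  have e : (p * r * p') / (p * r * p'') * ((p' * r' * p'') / (p' * r' * p)) *
      ((p'' * r'' * p) / (p'' * r'' * p')) = 1 := by
    field_simp
  linear_combination (wedge3 a₁ a₂ b₁ / wedge3 a₁ a₂ c₁ * (wedge3 b₁ b₂ c₁ / wedge3 b₁ b₂ a₁) *
      (wedge3 c₁ c₂ a₁ / wedge3 c₁ c₂ b₁)) * e

/-- The cross ratio `pcrAt` does not depend on the choice of representatives. -/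
theorem pcrAt_eq {A B C D : FullFlag} {a₁ a₂ b₁ b₂ c₁ c₂ d₁ d₂ : Fin 3 → ℝ}
    (hA : A.IsFrame a₁ a₂) (hB : B.IsFrame b₁ b₂) (hC : C.IsFrame c₁ c₂) (hD : D.IsFrame d₁ d₂) :
    pcrAt A B C D = wedge3 a₁ a₂ d₁ / wedge3 a₁ a₂ b₁ * (wedge3 a₁ c₁ b₁ / wedge3 a₁ c₁ d₁) := by
  obtain ⟨p, q, r, hp, hr, h1, h2⟩ := hA.change A.isFrame_vec
  obtain ⟨p', _, _, hp', _, h1', _⟩ := hB.change B.isFrame_vec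
  obtain ⟨p'', _, _, hp'', _, h1'', _⟩ := hC.change C.isFrame_vec
  obtain ⟨s, _, _, hs, _, h1s, _⟩ := hD.change D.isFrame_vec
  have key : ∀ (u v w : Fin 3 → ℝ) (s t k l : ℝ),
      wedge3 (s • u) (t • u + k • v) (l • w) = s * k * l * wedge3 u v w := by
    intro u v w s t k l
    simp [wedge3, Matrix.det_fin_three]
    ring
  have key' : ∀ (u v w : Fin 3 → ℝ) (s k l : ℝ),
      wedge3 (s • u) (k • v) (l • w) = s * k * l * wedge3 u v w := by
    intro u v w s k l
    simpa using key u v w s 0 k l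
  rw [pcrAt, h1, h2, h1', h1'', h1s]
  simp only [key, key']
  rw [mul_div_mul_comm, mul_div_mul_comm (p * p'' * p')]
  have e : (p * r * s) / (p * r * p') * ((p * p'' * p') / (p * p'' * s)) = 1 := by
    field_simp
  linear_combination (wedge3 a₁ a₂ d₁ / wedge3 a₁ a₂ b₁ *
    (wedge3 a₁ c₁ b₁ / wedge3 a₁ c₁ d₁)) * e

/-- The image of a flag under a linear automorphism of `ℝ³`. -/
def map (e : (Fin 3 → ℝ) ≃ₗ[ℝ] (Fin 3 → ℝ)) (A : FullFlag) : FullFlag where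
  line := A.line.map (e : (Fin 3 → ℝ) →ₗ[ℝ] (Fin 3 → ℝ))
  plane := A.plane.map (e : (Fin 3 → ℝ) →ₗ[ℝ] (Fin 3 → ℝ))
  finrank_line := by rw [LinearEquiv.finrank_map_eq, A.finrank_line]
  finrank_plane := by rw [LinearEquiv.finrank_map_eq, A.finrank_plane]
  line_le_plane := Submodule.map_mono A.line_le_plane

end FullFlag

/-! ### The group `PSL(3, ℝ)` -/

theorem mk_SL3_bijective : Function.Bijective
    (QuotientGroup.mk' (Subgroup.center SL(3, ℝ)) : SL(3, ℝ) →* PSL(3, ℝ)) := by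
  refine ⟨?_, QuotientGroup.mk'_surjective _⟩
  rw [← MonoidHom.ker_eq_bot_iff, QuotientGroup.ker_mk', eq_bot_iff]
  intro A hA
  obtain ⟨r, hr, hrA⟩ := Matrix.SpecialLinearGroup.mem_center_iff.1 hA
  have hr1 : r = 1 := by
    have h3 : r ^ 3 = 1 := by simpa using hr
    have h0 : (r - 1) * (r ^ 2 + r + 1) = 0 := by linear_combination h3
    rcases mul_eq_zero.1 h0 with h | h
    · linarith
    · nlinarith [sq_nonneg (r + 1 / 2)]
  rw [Subgroup.mem_bot]
  ext i j
  rw [← hrA, hr1]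
  simp

/-- The unique lift of an element of `PSL(3, ℝ)` to `SL(3, ℝ)` (the centre is trivial). -/
noncomputable def liftSL3 : PSL(3, ℝ) ≃* SL(3, ℝ) :=
  (MulEquiv.ofBijective (QuotientGroup.mk' (Subgroup.center SL(3, ℝ))) mk_SL3_bijective).symm

/-- The action of `PSL(3, ℝ)` on flags. -/
noncomputable def flagAct (g : PSL(3, ℝ)) (A : FullFlag) : FullFlag :=
  A.map (Matrix.SpecialLinearGroup.toLin' (liftSL3 g))

/-- The moduli of the (generalized, complex) eigenvalues, counted with multiplicity, in
non-increasing order. -/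
noncomputable def eigenvalueModuli (g : PSL(3, ℝ)) : List ℝ :=
  ((((liftSL3 g : Matrix (Fin 3) (Fin 3) ℝ).map Complex.ofReal).charpoly.roots).map
    (fun z : ℂ => ‖z‖)).sort (fun a b => b ≤ a)

/-- The length function `ℓ_{α₁}(g) = log |λ₁(g) / λ₂(g)|` of the first simple root. -/
noncomputable def rootLength (g : PSL(3, ℝ)) : ℝ :=
  Real.log ((eigenvalueModuli g).getD 0 0 / (eigenvalueModuli g).getD 1 0)

/-! ### Positive representations and Fock-Goncharov coordinates -/

/-- `ξ` is a positive framing of the representation `ρ` (so that `ρ` is a positive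
representation): a `ρ`-equivariant map from the cusps to the flags that is positive, that is, the
flags at the vertices of any ideal polygon have positive Fock-Goncharov coordinates with respect
to any triangulation of the polygon. These coordinates are read off from the quadruples of
vertices in cyclic order. -/
def IsPositiveFraming (ρ : Gamma11 →* PSL(3, ℝ)) (ξ : Cusp → FullFlag) : Prop :=
  (∀ (g : Gamma11) (c : Cusp), ξ (cuspAct g c) = flagAct (ρ g) (ξ c)) ∧
    ∀ a b c d : Cusp, Cusp.Cyclic a b c d →
      FullFlag.IsPositiveQuadruple (ξ a) (ξ b) (ξ c) (ξ d)

/-- The framing `ξ` has all shears zero and triple ratios `t`, `t'` with respect to the ideal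
triangulation of the once-punctured torus given by the square with vertices `0, 1, ∞, -1` and its
diagonal `(0, ∞)`: the triangles are `(0, 1, ∞)` and `(∞, -1, 0)`, and the edges are the
diagonal, the vertical side `(1, ∞)` and the horizontal side `(-1, ∞)`. -/
def HasZeroShearsAndTripleRatios (ξ : Cusp → FullFlag) (t t' : ℝ) : Prop :=
  let v : ℚ → FullFlag := fun q => ξ (q : OnePoint ℚ)
  let vinf : FullFlag := ξ OnePoint.infty
  FullFlag.tripleRatio (v 0) (v 1) vinf = t ∧
    FullFlag.tripleRatio vinf (v (-1)) (v 0) = t' ∧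
    FullFlag.shear vinf (v (-1)) (v 0) (v 1) = (0, 0) ∧
    FullFlag.shear vinf (v 0) (v 1) (v 2) = (0, 0) ∧
    FullFlag.shear vinf (v (-2)) (v (-1)) (v 0) = (0, 0)

/-! Write `T` for `z ↦ z + 1` and `L` for `z ↦ z / (z + 1)`, so that `γ = T L` and `δ = T⁻¹ L⁻¹` in
the modular group. The lifted triangulation is the Farey triangulation. When all shears vanish, `T`
and `L` preserve the prescribed coordinates except that they exchange the two triple ratios. With `u
^ 3 = x` they are therefore realized by explicit matrices `upperStep u` and `lowerStep u` that carry
the framing of parameter `u⁻¹` to the framing of parameter `u`. The representation is the resulting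
twisted product over `γ` and `δ`, and `braid_relation` makes it compatible with conjugation by `T`
and `L`.

The framing sends `∞` to the standard flag and is transported by the group, which acts transitively
on the cusps. It is well defined: the holonomy is faithful (ping-pong), so the stabilizer of `∞`
centralizes the peripheral element, whose image is unipotent with a single Jordan block and hence
has a centralizer fixing the standard flag.

For positivity, the first cusp is moved to `∞`. In the affine chart complementary to its flag, a
quadruple is positive as soon as the other three flags are points and support lines of a strictly
convex graph, in order from left to right. This condition on pairs is transitive, so it suffices to
check Farey neighbours (`Rat.rel_of_lt_of_farey`). A neighbouring pair is the image of `(0, ∞)`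
under a modular matrix with positive bottom row. The Euclidean algorithm writes that matrix in `T`
and `L`, whose realizations preserve a sign condition on minors (`IsConvexFrame`).

For the lengths, `γ` and `δ` have the same characteristic polynomial. After scaling the variable by
`u⁻¹` its roots are those of `t (t - 2)² = x (2 t - 1)²`, and the two largest both tend to `2` as `x
→ 0`. -/

/-! ### The modular group acting on the cusps -/

namespace Cusp

/-- The Möbius action of `SL(2, ℤ)` on the cusps. -/
noncomputable def move (A : SL(2, ℤ)) (c : Cusp) : Cusp :=
  Matrix.SpecialLinearGroup.mapGL ℚ A • c

theorem move_mul (A B : SL(2, ℤ)) (c : Cusp) : move (A * B) c = move A (move B c) := by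
  simp [move, mul_smul]

@[simp] theorem move_one (c : Cusp) : move 1 c = c := by simp [move]

theorem move_infty (A : SL(2, ℤ)) :
    move A OnePoint.infty =
      if A 1 0 = 0 then OnePoint.infty else (((A 0 0 : ℚ) / (A 1 0 : ℚ) : ℚ) : Cusp) := by
  simp [move, OnePoint.smul_infty_eq_ite]

theorem move_coe (A : SL(2, ℤ)) (q : ℚ) :
    move A (q : Cusp) =
      if (A 1 0 : ℚ) * q + A 1 1 = 0 then OnePoint.infty
      else ((((A 0 0 : ℚ) * q + A 0 1) / ((A 1 0 : ℚ) * q + A 1 1) : ℚ) : Cusp) := by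
  simp [move, OnePoint.smul_some_eq_ite]

/-- A vector of homogeneous coordinates of a cusp. -/
def vec : Cusp → ℚ × ℚ := fun c => OnePoint.elim c (1, 0) (fun q : ℚ => (q, 1))

@[simp] theorem vec_infty : vec OnePoint.infty = (1, 0) := rfl

@[simp] theorem vec_coe (q : ℚ) : vec (q : Cusp) = (q, 1) := rfl

/-- The orientation of a triple of cusps: positive if the triple is counterclockwise. -/
def orient (a b c : Cusp) : ℚ :=
  ((vec a).1 * (vec b).2 - (vec a).2 * (vec b).1) *
  ((vec b).1 * (vec c).2 - (vec b).2 * (vec c).1) *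
  ((vec c).1 * (vec a).2 - (vec c).2 * (vec a).1)

theorem exists_vec_move (A : SL(2, ℤ)) (c : Cusp) :
    ∃ k : ℚ, k ≠ 0 ∧ (A 0 0 : ℚ) * (vec c).1 + A 0 1 * (vec c).2 = k * (vec (move A c)).1 ∧
      (A 1 0 : ℚ) * (vec c).1 + A 1 1 * (vec c).2 = k * (vec (move A c)).2 := by
  have hdet : (A 0 0 : ℚ) * A 1 1 - A 0 1 * A 1 0 = 1 := by
    have := A.det_coe
    rw [Matrix.det_fin_two] at this
    exact_mod_cast this
  induction c using OnePoint.rec with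
  | infty =>
    rw [move_infty]
    split_ifs with h
    · refine ⟨A 0 0, ?_, by simp, by simp [h]⟩
      intro h0
      simp [h, h0] at hdet
    · have h' : (A 1 0 : ℚ) ≠ 0 := by exact_mod_cast h
      exact ⟨A 1 0, h', by simp; field_simp, by simp⟩
  | coe q =>
    rw [move_coe]
    split_ifs with h
    · refine ⟨A 0 0 * q + A 0 1, ?_, by simp, by simpa using h⟩
      intro h0
      have : (1 : ℚ) = 0 := by
        rw [← hdet]
        by_cases hq : (A 1 0 : ℚ) = 0
        · have h1 : (A 1 1 : ℚ) = 0 := by simpa [hq] using h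
          rw [hq, h1]; ring
        · have e : (A 1 0 : ℚ) * ((A 0 0 : ℚ) * A 1 1 - A 0 1 * A 1 0) = 0 := by
            linear_combination (A 0 0 : ℚ) * A 1 0 * h - (A 1 0 : ℚ) ^ 2 * h0
          exact (mul_eq_zero.1 e).resolve_left hq
      exact one_ne_zero this
    · exact ⟨_, h, by simp [mul_div_cancel₀ _ h], by simp⟩

/-- Each homogeneous vector occurs twice in `orient`, so the scalars of `exists_vec_move` enter
squared, and the determinant one leaves the pairwise minors unchanged. -/
theorem orient_move_pos {a b c : Cusp} (A : SL(2, ℤ)) (h : 0 < orient a b c) :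
    0 < orient (move A a) (move A b) (move A c) := by
  obtain ⟨k, hk, k1, k2⟩ := exists_vec_move A a
  obtain ⟨l, hl, l1, l2⟩ := exists_vec_move A b
  obtain ⟨m, hm, m1, m2⟩ := exists_vec_move A c
  have hdet : (A 0 0 : ℚ) * A 1 1 - A 0 1 * A 1 0 = 1 := by
    have := A.det_coe
    rw [Matrix.det_fin_two] at this
    exact_mod_cast this
  have key : ∀ (p q p' q' k l P Q P' Q' : ℚ), (A 0 0 : ℚ) * p + A 0 1 * q = k * P →
      (A 1 0 : ℚ) * p + A 1 1 * q = k * Q → (A 0 0 : ℚ) * p' + A 0 1 * q' = l * P' →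
      (A 1 0 : ℚ) * p' + A 1 1 * q' = l * Q' → p * q' - q * p' = k * l * (P * Q' - Q * P') := by
    intro p q p' q' k l P Q P' Q' h1 h2 h3 h4
    have : k * l * (P * Q' - Q * P') = (k * P) * (l * Q') - (k * Q) * (l * P') := by ring
    rw [this, ← h1, ← h2, ← h3, ← h4]
    linear_combination -(p * q' - q * p') * hdet
  have e : orient a b c =
      (k * l * m) ^ 2 * orient (move A a) (move A b) (move A c) := by
    rw [orient, orient, key _ _ _ _ _ _ _ _ _ _ k1 k2 l1 l2, key _ _ _ _ _ _ _ _ _ _ l1 l2 m1 m2,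
      key _ _ _ _ _ _ _ _ _ _ m1 m2 k1 k2]
    ring
  rw [e] at h
  exact pos_of_mul_pos_right h (sq_nonneg _)

theorem lt_coe_coe (a b : ℚ) : Cusp.lt (a : Cusp) (b : Cusp) ↔ a < b := by
  simp [Cusp.lt]

theorem not_infty_lt (a : Cusp) : ¬ Cusp.lt OnePoint.infty a := by
  simp [Cusp.lt]

theorem lt_trans {a b c : Cusp} (h : Cusp.lt a b) (h' : Cusp.lt b c) : Cusp.lt a c :=
  _root_.lt_trans h h'

theorem orient_rotate (a b c : Cusp) : orient b c a = orient a b c := by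
  simp only [orient]; ring

theorem orient_pos_of_lt {a b c : Cusp} (h : Cusp.lt a b) (h' : Cusp.lt b c) :
    0 < orient a b c := by
  induction a using OnePoint.rec with
  | infty => exact absurd h (not_infty_lt _)
  | coe a =>
  induction b using OnePoint.rec with
  | infty => exact absurd h' (not_infty_lt _)
  | coe b =>
  rw [lt_coe_coe] at h
  induction c using OnePoint.rec with
  | infty => simp [orient]; linarith
  | coe c =>
    rw [lt_coe_coe] at h'
    simp only [orient, vec_coe, mul_one, one_mul]
    have := mul_pos (mul_pos (sub_pos.2 h) (sub_pos.2 h')) (sub_pos.2 (h.trans h'))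
    linarith

theorem Cyclic.orient_pos {a b c d : Cusp} (h : Cusp.Cyclic a b c d) :
    0 < orient a b c ∧ 0 < orient a c d := by
  rcases h with ⟨h1, h2, h3⟩ | ⟨h1, h2, h3⟩ | ⟨h1, h2, h3⟩ | ⟨h1, h2, h3⟩
  · exact ⟨orient_pos_of_lt h1 h2, orient_pos_of_lt (lt_trans h1 h2) h3⟩
  · exact ⟨by rw [← orient_rotate]; exact orient_pos_of_lt h1 (lt_trans h2 h3),
      by rw [← orient_rotate]; exact orient_pos_of_lt h2 h3⟩
  · exact ⟨by rw [← orient_rotate, ← orient_rotate]; exact orient_pos_of_lt (lt_trans h1 h2) h3,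
      by rw [← orient_rotate]; exact orient_pos_of_lt h1 h2⟩
  · exact ⟨orient_pos_of_lt h2 h3,
      by rw [← orient_rotate, ← orient_rotate]; exact orient_pos_of_lt h1 (lt_trans h2 h3)⟩

theorem exists_coe_of_orient_pos {b c : Cusp} (h : 0 < orient OnePoint.infty b c) :
    ∃ p q : ℚ, b = (p : Cusp) ∧ c = (q : Cusp) ∧ p < q := by
  induction b using OnePoint.rec with
  | infty => simp [orient] at h
  | coe b =>
  induction c using OnePoint.rec with
  | infty => simp [orient] at h
  | coe c =>
    refine ⟨b, c, rfl, rfl, ?_⟩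
    simp [orient] at h
    linarith

end Cusp

/-! ### Generators, holonomy and the cuspidal translation by 6 -/

namespace Gamma11

/-- The parabolic element `z ↦ z + 1` of the modular group. -/
def upperShear : SL(2, ℤ) := ⟨!![1, 1; 0, 1], by simp [Matrix.det_fin_two_of]⟩

/-- The parabolic element `z ↦ z / (z + 1)` of the modular group. -/
def lowerShear : SL(2, ℤ) := ⟨!![1, 0; 1, 1], by simp [Matrix.det_fin_two_of]⟩

/-- The side pairing `γ` as a matrix. -/
def matγ : SL(2, ℤ) := ⟨!![2, 1; 1, 1], by simp [Matrix.det_fin_two_of]⟩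

/-- The side pairing `δ` as a matrix. -/
def matδ : SL(2, ℤ) := ⟨!![2, -1; -1, 1], by simp [Matrix.det_fin_two_of]⟩

theorem coe_upperShear : (upperShear : Matrix (Fin 2) (Fin 2) ℤ) = !![1, 1; 0, 1] := rfl

theorem coe_lowerShear : (lowerShear : Matrix (Fin 2) (Fin 2) ℤ) = !![1, 0; 1, 1] := rfl

theorem coe_matγ : (matγ : Matrix (Fin 2) (Fin 2) ℤ) = !![2, 1; 1, 1] := rfl

theorem coe_matδ : (matδ : Matrix (Fin 2) (Fin 2) ℤ) = !![2, -1; -1, 1] := rfl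

theorem holonomy_γ : holonomy γ = matγ := by
  simp only [holonomy, γ, FreeGroup.lift_apply_of]; rfl

theorem holonomy_δ : holonomy δ = matδ := by
  simp only [holonomy, δ, FreeGroup.lift_apply_of]; rfl

theorem matδ_eq : matδ = upperShear⁻¹ * lowerShear⁻¹ := by decide +kernel

/-- The loop around the puncture, which fixes the cusp `∞`. -/
def peripheral : Gamma11 := γ * δ * γ⁻¹ * δ⁻¹

theorem holonomy_peripheral :
    (holonomy peripheral : Matrix (Fin 2) (Fin 2) ℤ) = !![-1, -6; 0, -1] := by
  rw [peripheral, map_mul, map_mul, map_mul, map_inv, map_inv, holonomy_γ, holonomy_δ]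
  decide +kernel

theorem hom_ext {G : Type*} [Group G] {f g : Gamma11 →* G} (h : f γ = g γ) (h' : f δ = g δ) :
    f = g := by
  refine FreeGroup.ext_hom _ _ fun i => ?_
  fin_cases i
  · exact h
  · exact h'

theorem cuspAct_eq (g : Gamma11) (c : Cusp) : cuspAct g c = Cusp.move (holonomy g) c := rfl

theorem cuspAct_mul (g h : Gamma11) (c : Cusp) : cuspAct (g * h) c = cuspAct g (cuspAct h c) := by
  simp [cuspAct_eq, Cusp.move_mul]

theorem cuspAct_one (c : Cusp) : cuspAct 1 c = c := by
  simp [cuspAct_eq]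

theorem cuspAct_inv_eq_iff {g : Gamma11} {c d : Cusp} : cuspAct g⁻¹ c = d ↔ c = cuspAct g d := by
  constructor
  · rintro rfl
    rw [← cuspAct_mul, mul_inv_cancel, cuspAct_one]
  · rintro rfl
    rw [← cuspAct_mul, inv_mul_cancel, cuspAct_one]

theorem cuspAct_γ_infty : cuspAct γ OnePoint.infty = ((2 : ℚ) : Cusp) := by
  simp [cuspAct_eq, holonomy_γ, Cusp.move_infty, coe_matγ]

theorem cuspAct_γ_coe (q : ℚ) : cuspAct γ (q : Cusp) =
    if q + 1 = 0 then OnePoint.infty else (((2 * q + 1) / (q + 1) : ℚ) : Cusp) := by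
  simp [cuspAct_eq, holonomy_γ, Cusp.move_coe, coe_matγ]

theorem cuspAct_γ_inv_infty : cuspAct γ⁻¹ OnePoint.infty = ((-1 : ℚ) : Cusp) := by
  simp [cuspAct_eq, holonomy_γ, Cusp.move_infty, coe_matγ, Matrix.adjugate_fin_two_of]

theorem cuspAct_γ_inv_coe (q : ℚ) : cuspAct γ⁻¹ (q : Cusp) =
    if -q + 2 = 0 then OnePoint.infty else (((q + -1) / (-q + 2) : ℚ) : Cusp) := by
  simp [cuspAct_eq, holonomy_γ, Cusp.move_coe, coe_matγ, Matrix.adjugate_fin_two_of]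

theorem cuspAct_δ_infty : cuspAct δ OnePoint.infty = ((-2 : ℚ) : Cusp) := by
  norm_num [cuspAct_eq, holonomy_δ, Cusp.move_infty, coe_matδ]

theorem cuspAct_δ_coe (q : ℚ) : cuspAct δ (q : Cusp) =
    if -q + 1 = 0 then OnePoint.infty else (((2 * q + -1) / (-q + 1) : ℚ) : Cusp) := by
  simp [cuspAct_eq, holonomy_δ, Cusp.move_coe, coe_matδ]

theorem cuspAct_δ_inv_infty : cuspAct δ⁻¹ OnePoint.infty = ((1 : ℚ) : Cusp) := by
  simp [cuspAct_eq, holonomy_δ, Cusp.move_infty, coe_matδ, Matrix.adjugate_fin_two_of]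

theorem cuspAct_δ_inv_coe (q : ℚ) : cuspAct δ⁻¹ (q : Cusp) =
    if q + 2 = 0 then OnePoint.infty else (((q + 1) / (q + 2) : ℚ) : Cusp) := by
  simp [cuspAct_eq, holonomy_δ, Cusp.move_coe, coe_matδ, Matrix.adjugate_fin_two_of]

theorem cuspAct_peripheral_coe (q : ℚ) : cuspAct peripheral (q : Cusp) = ((q + 6 : ℚ) : Cusp) := by
  simp [cuspAct_eq, Cusp.move_coe, holonomy_peripheral]
  ring

theorem cuspAct_peripheral_pow_coe (n : ℕ) (q : ℚ) :
    cuspAct (peripheral ^ n) (q : Cusp) = ((q + 6 * n : ℚ) : Cusp) := by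
  induction n with
  | zero => simp [cuspAct_one]
  | succ n ih =>
    rw [pow_succ', cuspAct_mul, ih, cuspAct_peripheral_coe]
    push_cast
    congr 1
    ring

theorem cuspAct_peripheral_zpow_coe (n : ℤ) (q : ℚ) :
    cuspAct (peripheral ^ n) (q : Cusp) = ((q + 6 * n : ℚ) : Cusp) := by
  cases n with
  | ofNat n => simpa using cuspAct_peripheral_pow_coe n q
  | negSucc n =>
    rw [zpow_negSucc, cuspAct_inv_eq_iff, cuspAct_peripheral_pow_coe]
    congr 1
    push_cast [Int.negSucc_eq]
    ring

end Gamma11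

/-! ### Transitivity on the cusps -/

namespace Gamma11

theorem exists_cuspAct_infty_int (n : ℤ) : ∃ g, cuspAct g OnePoint.infty = ((n : ℚ) : Cusp) := by
  have key : ∀ (g : Gamma11) (r : ℤ), n % 6 = r → cuspAct g OnePoint.infty = ((r : ℚ) : Cusp) →
      ∃ g, cuspAct g OnePoint.infty = ((n : ℚ) : Cusp) := by
    intro g r hr hg
    refine ⟨peripheral ^ (n / 6) * g, ?_⟩
    rw [cuspAct_mul, hg, cuspAct_peripheral_zpow_coe]
    have := Int.emod_add_mul_ediv n 6
    rw [hr] at this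
    congr 1
    exact_mod_cast this
  -- The representatives `-2` and `-1` are not remainders modulo 6; one more peripheral translation
  -- corrects this.
  have key' : ∀ (g : Gamma11) (r : ℤ), n % 6 = r + 6 → cuspAct g OnePoint.infty = ((r : ℚ) : Cusp) →
      ∃ g, cuspAct g OnePoint.infty = ((n : ℚ) : Cusp) := by
    intro g r hr hg
    refine key (peripheral * g) (r + 6) hr ?_
    rw [cuspAct_mul, hg, cuspAct_peripheral_coe]
    push_cast
    rfl
  have h0 := Int.emod_nonneg n (show (6 : ℤ) ≠ 0 by norm_num)
  have h6 := Int.emod_lt_of_pos n (show (0 : ℤ) < 6 by norm_num)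
  have hcases : n % 6 = 0 ∨ n % 6 = 1 ∨ n % 6 = 2 ∨ n % 6 = 3 ∨ n % 6 = -2 + 6 ∨
      n % 6 = -1 + 6 := by omega
  rcases hcases with h | h | h | h | h | h
  · refine key (γ⁻¹ * δ⁻¹) 0 h ?_
    rw [cuspAct_mul, cuspAct_δ_inv_infty, cuspAct_γ_inv_coe]
    norm_num
  · exact key δ⁻¹ 1 h (by rw [cuspAct_δ_inv_infty]; norm_num)
  · exact key γ 2 h (by rw [cuspAct_γ_infty]; norm_num)
  · refine key (γ * δ) 3 h ?_
    rw [cuspAct_mul, cuspAct_δ_infty, cuspAct_γ_coe]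
    norm_num
  · exact key' δ (-2) h (by rw [cuspAct_δ_infty]; norm_num)
  · exact key' γ⁻¹ (-1) h (by rw [cuspAct_γ_inv_infty]; norm_num)

theorem cuspAct_γ_div {a b : ℚ} (hb : b ≠ 0) (h : a + b ≠ 0) :
    cuspAct γ ((a / b : ℚ) : Cusp) = (((2 * a + b) / (a + b) : ℚ) : Cusp) := by
  have e : a / b + 1 = (a + b) / b := by field_simp
  rw [cuspAct_γ_coe, e, if_neg (div_ne_zero h hb)]
  congr 1
  field_simp

theorem cuspAct_γ_inv_div {a b : ℚ} (hb : b ≠ 0) (h : -a + 2 * b ≠ 0) :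
    cuspAct γ⁻¹ ((a / b : ℚ) : Cusp) = (((a - b) / (-a + 2 * b) : ℚ) : Cusp) := by
  have e : -(a / b) + 2 = (-a + 2 * b) / b := by field_simp
  rw [cuspAct_γ_inv_coe, e, if_neg (div_ne_zero h hb)]
  congr 1
  field_simp
  ring

theorem cuspAct_δ_div {a b : ℚ} (hb : b ≠ 0) (h : -a + b ≠ 0) :
    cuspAct δ ((a / b : ℚ) : Cusp) = (((2 * a - b) / (-a + b) : ℚ) : Cusp) := by
  have e : -(a / b) + 1 = (-a + b) / b := by field_simp
  rw [cuspAct_δ_coe, e, if_neg (div_ne_zero h hb)]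
  congr 1
  field_simp
  ring

theorem cuspAct_δ_inv_div {a b : ℚ} (hb : b ≠ 0) (h : a + 2 * b ≠ 0) :
    cuspAct δ⁻¹ ((a / b : ℚ) : Cusp) = (((a + b) / (a + 2 * b) : ℚ) : Cusp) := by
  have e : a / b + 2 = (a + 2 * b) / b := by field_simp
  rw [cuspAct_δ_inv_coe, e, if_neg (div_ne_zero h hb)]
  congr 1
  field_simp

/-- Descent on the denominator. Peripheral translations bring `m / n` into `[-3, 3)`. There, unless
the fraction is an integer, one of the four elements `γ^{±1}`, `δ^{±1}` makes the denominator
strictly smaller in absolute value. -/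
theorem exists_cuspAct_infty_div (k : ℕ) : ∀ (m n : ℤ), 0 < n → n ≤ k →
    ∃ g, cuspAct g OnePoint.infty = (((m : ℚ) / n : ℚ) : Cusp) := by
  induction k with
  | zero => intro m n h h'; exact absurd h (by simpa using h')
  | succ k ih =>
  have step : ∀ (m n : ℤ), 0 < n → n ≤ k + 1 → -3 * n ≤ m → m < 3 * n →
      ∃ g, cuspAct g OnePoint.infty = (((m : ℚ) / n : ℚ) : Cusp) := by
    intro m n hn hnk h1 h2
    have hn' : (n : ℚ) ≠ 0 := by exact_mod_cast hn.ne'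
    -- The new denominator may be negative; both signs are then changed before the induction
    -- hypothesis is applied.
    have reduce : ∀ (t : Gamma11) (m' n' : ℤ), n' ≠ 0 → -n < n' → n' < n →
        cuspAct t (((m' : ℚ) / n' : ℚ) : Cusp) = (((m : ℚ) / n : ℚ) : Cusp) →
        ∃ g, cuspAct g OnePoint.infty = (((m : ℚ) / n : ℚ) : Cusp) := by
      intro t m' n' h0 h h' ht
      obtain ⟨g, hg⟩ : ∃ g, cuspAct g OnePoint.infty = (((m' : ℚ) / n' : ℚ) : Cusp) := by
        rcases lt_or_gt_of_ne h0 with hneg | hpos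
        · have := ih (-m') (-n') (by omega) (by omega)
          simpa [neg_div_neg_eq] using this
        · exact ih m' n' hpos (by omega)
      exact ⟨t * g, by rw [cuspAct_mul, hg, ht]⟩
    have ne_cast : ∀ k : ℤ, k ≠ 0 → (k : ℚ) ≠ 0 := fun k hk => by exact_mod_cast hk
    by_cases hd : ∃ j : ℤ, m = j * n
    · obtain ⟨j, rfl⟩ := hd
      obtain ⟨g, hg⟩ := exists_cuspAct_infty_int j
      refine ⟨g, hg.trans ?_⟩
      congr 1
      push_cast
      field_simp
    push Not at hd
    have hm1 : m ≠ n := by simpa using hd 1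
    have hm0 : m ≠ 0 := by simpa using hd 0
    have hm1' : m ≠ -n := by simpa using hd (-1)
    have hm3 : m ≠ -3 * n := hd (-3)
    have hm2 : m ≠ 2 * n := hd 2
    have hm2' : m ≠ -2 * n := hd (-2)
    rcases lt_or_gt_of_ne hm0 with hneg | hpos
    · rcases lt_or_gt_of_ne hm1' with h | h
      · have hs : m + 2 * n ≠ 0 := by omega
        refine reduce δ (m + n) (m + 2 * n) hs (by omega) (by omega) ?_
        rw [cuspAct_δ_div (ne_cast _ hs) (by push_cast; ring_nf; exact hn')]
        congr 1
        push_cast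
        ring_nf
      · have hs : m + n ≠ 0 := by omega
        refine reduce γ⁻¹ (2 * m + n) (m + n) hs (by omega) (by omega) ?_
        rw [cuspAct_γ_inv_div (ne_cast _ hs) (by push_cast; ring_nf; exact hn')]
        congr 1
        push_cast
        ring_nf
    · rcases lt_or_gt_of_ne hm1 with h | h
      · have hs : n - m ≠ 0 := by omega
        refine reduce δ⁻¹ (2 * m - n) (n - m) hs (by omega) (by omega) ?_
        rw [cuspAct_δ_inv_div (ne_cast _ hs) (by push_cast; ring_nf; exact hn')]
        congr 1
        push_cast
        ring_nf
      · have hs : 2 * n - m ≠ 0 := by omega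
        refine reduce γ (m - n) (2 * n - m) hs (by omega) (by omega) ?_
        rw [cuspAct_γ_div (ne_cast _ hs) (by push_cast; ring_nf; exact hn')]
        congr 1
        push_cast
        ring_nf
  intro m n hn hnk
  set j : ℤ := (m + 3 * n) / (6 * n) with hj
  have h6 : 0 < 6 * n := by omega
  have hmod := Int.emod_add_mul_ediv (m + 3 * n) (6 * n)
  have h0 := Int.emod_nonneg (m + 3 * n) h6.ne'
  have h1 := Int.emod_lt_of_pos (m + 3 * n) h6
  rw [← hj] at hmod
  obtain ⟨g, hg⟩ := step (m - 6 * n * j) n hn (by exact_mod_cast hnk) (by omega) (by omega)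
  refine ⟨peripheral ^ j * g, ?_⟩
  rw [cuspAct_mul, hg, cuspAct_peripheral_zpow_coe]
  have hn' : (n : ℚ) ≠ 0 := by exact_mod_cast hn.ne'
  congr 1
  push_cast
  field_simp
  ring

/-- The fundamental group of the once-punctured torus acts transitively on the cusps. -/
theorem exists_cuspAct_infty (c : Cusp) : ∃ g, cuspAct g OnePoint.infty = c := by
  induction c using OnePoint.rec with
  | infty => exact ⟨1, cuspAct_one _⟩
  | coe q =>
    obtain ⟨g, hg⟩ := exists_cuspAct_infty_div q.den q.num q.den (by exact_mod_cast q.pos) le_rfl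
    refine ⟨g, hg.trans ?_⟩
    congr 1
    exact_mod_cast q.num_div_den

/-! ### Ping-pong and faithfulness of the holonomy -/

/-- The intervals of the ping-pong argument that attract the positive powers. -/
def attracting : Fin 2 → Set Cusp :=
  ![{c | ∃ q : ℚ, c = (q : Cusp) ∧ 1 ≤ q}, {c | ∀ q : ℚ, c = (q : Cusp) → q < -1}]

/-- The intervals of the ping-pong argument that attract the negative powers. -/
def repelling : Fin 2 → Set Cusp :=
  ![{c | ∃ q : ℚ, c = (q : Cusp) ∧ -1 ≤ q ∧ q < 0}, {c | ∃ q : ℚ, c = (q : Cusp) ∧ 0 ≤ q ∧ q < 1}]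

theorem cuspAct_γ_mem_attracting {c : Cusp} (hc : c ∉ repelling 0) :
    cuspAct γ c ∈ attracting 0 := by
  induction c using OnePoint.rec with
  | infty => exact ⟨2, cuspAct_γ_infty, by norm_num⟩
  | coe q =>
    have hq : ¬ (-1 ≤ q ∧ q < 0) := fun h => hc ⟨q, rfl, h⟩
    have h1 : q + 1 ≠ 0 := fun h => hq ⟨by linarith, by linarith⟩
    refine ⟨(2 * q + 1) / (q + 1), by rw [cuspAct_γ_coe, if_neg h1], ?_⟩
    have e : (2 * q + 1) / (q + 1) = 1 + q / (q + 1) := by field_simp; ring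
    rw [e]
    rcases lt_or_ge q (-1) with h | h
    · have := div_nonneg_of_nonpos (show q ≤ 0 by linarith) (show q + 1 ≤ 0 by linarith)
      linarith
    · have h0 : 0 ≤ q := by
        by_contra h0
        exact hq ⟨h, not_le.1 h0⟩
      have : 0 ≤ q / (q + 1) := by positivity
      linarith

theorem cuspAct_γ_inv_mem_repelling {c : Cusp} (hc : c ∉ attracting 0) :
    cuspAct γ⁻¹ c ∈ repelling 0 := by
  induction c using OnePoint.rec with
  | infty => exact ⟨-1, cuspAct_γ_inv_infty, by norm_num⟩
  | coe q =>
    have hq : q < 1 := not_le.1 fun h => hc ⟨q, rfl, h⟩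
    have h1 : 0 < -q + 2 := by linarith
    refine ⟨(q + -1) / (-q + 2), by rw [cuspAct_γ_inv_coe, if_neg h1.ne'], ?_, ?_⟩
    · rw [le_div_iff₀ h1]; linarith
    · rw [div_lt_iff₀ h1]; linarith

theorem cuspAct_δ_mem_attracting {c : Cusp} (hc : c ∉ repelling 1) :
    cuspAct δ c ∈ attracting 1 := by
  induction c using OnePoint.rec with
  | infty =>
    intro q h
    rw [cuspAct_δ_infty, OnePoint.coe_eq_coe] at h
    rw [← h]; norm_num
  | coe q =>
    have hq : ¬ (0 ≤ q ∧ q < 1) := fun h => hc ⟨q, rfl, h⟩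
    intro r hr
    rw [cuspAct_δ_coe] at hr
    split_ifs at hr with h
    · exact absurd hr (OnePoint.infty_ne_coe r)
    · rw [OnePoint.coe_eq_coe] at hr
      have e : (2 * q + -1) / (-q + 1) = -1 + q / (-q + 1) := by field_simp; ring
      rw [← hr, e]
      rcases lt_or_ge q 0 with h0 | h0
      · have := div_neg_of_neg_of_pos h0 (show 0 < -q + 1 by linarith)
        linarith
      · have h1 : 1 ≤ q := by
          by_contra h1
          exact hq ⟨h0, not_le.1 h1⟩
        have h2 : -q + 1 < 0 := lt_of_le_of_ne (by linarith) h
        have := div_neg_of_pos_of_neg (show 0 < q by linarith) h2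
        linarith

theorem cuspAct_δ_inv_mem_repelling {c : Cusp} (hc : c ∉ attracting 1) :
    cuspAct δ⁻¹ c ∈ repelling 1 := by
  induction c using OnePoint.rec with
  -- `∞` belongs to `attracting 1` vacuously; with this convention the four sets partition the
  -- cusps.
  | infty => exact absurd (fun q h => absurd h (OnePoint.infty_ne_coe q)) hc
  | coe q =>
    have hq : -1 ≤ q := by
      by_contra h
      refine hc fun r hr => ?_
      rw [OnePoint.coe_eq_coe] at hr
      rw [← hr]; exact not_le.1 h
    have h1 : 0 < q + 2 := by linarith
    refine ⟨(q + 1) / (q + 2), by rw [cuspAct_δ_inv_coe, if_neg h1.ne'], ?_, ?_⟩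
    · exact div_nonneg (by linarith) h1.le
    · rw [div_lt_one h1]; linarith

theorem disjoint_attracting : Disjoint (attracting 0) (attracting 1) := by
  rw [Set.disjoint_left]
  rintro c ⟨q, rfl, hq⟩ h
  have := h q rfl
  linarith

theorem disjoint_repelling : Disjoint (repelling 0) (repelling 1) := by
  rw [Set.disjoint_left]
  rintro c ⟨q, rfl, hq, hq'⟩ ⟨r, hr, h⟩
  rw [OnePoint.coe_eq_coe] at hr
  linarith

theorem disjoint_attracting_repelling (i j : Fin 2) : Disjoint (attracting i) (repelling j) := by
  rw [Set.disjoint_left]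
  fin_cases i <;> fin_cases j
  · rintro c ⟨q, rfl, hq⟩ ⟨r, hr, h, h'⟩
    rw [OnePoint.coe_eq_coe] at hr
    linarith
  · rintro c ⟨q, rfl, hq⟩ ⟨r, hr, h, h'⟩
    rw [OnePoint.coe_eq_coe] at hr
    linarith
  · rintro c hc ⟨r, hr, h, h'⟩
    have := hc r hr
    linarith
  · rintro c hc ⟨r, hr, h, h'⟩
    have := hc r hr
    linarith

/-- The holonomy of the punctured torus is faithful, by the ping-pong lemma. -/
theorem holonomy_injective : Function.Injective holonomy := by
  -- Ping-pong is played in `GL(2, ℚ)`, the group acting on the cusps; injectivity of the composite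
  -- map descends to `holonomy`.
  have hcomp : FreeGroup.lift (fun i => Matrix.SpecialLinearGroup.mapGL ℚ (sidePairing i)) =
      (Matrix.SpecialLinearGroup.mapGL ℚ).comp holonomy :=
    FreeGroup.ext_hom _ _ fun i => by simp [holonomy]
  have h0 : ∀ c : Cusp, Matrix.SpecialLinearGroup.mapGL ℚ (sidePairing 0) • c = cuspAct γ c :=
    fun c => by rw [cuspAct, holonomy_γ]; rfl
  have h1 : ∀ c : Cusp, Matrix.SpecialLinearGroup.mapGL ℚ (sidePairing 1) • c = cuspAct δ c :=
    fun c => by rw [cuspAct, holonomy_δ]; rfl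
  have h0' : ∀ c : Cusp,
      (Matrix.SpecialLinearGroup.mapGL ℚ (sidePairing 0))⁻¹ • c = cuspAct γ⁻¹ c :=
    fun c => by rw [cuspAct, map_inv, holonomy_γ, map_inv]; rfl
  have h1' : ∀ c : Cusp,
      (Matrix.SpecialLinearGroup.mapGL ℚ (sidePairing 1))⁻¹ • c = cuspAct δ⁻¹ c :=
    fun c => by rw [cuspAct, map_inv, holonomy_δ, map_inv]; rfl
  have hinj : Function.Injective
      (FreeGroup.lift (fun i => Matrix.SpecialLinearGroup.mapGL ℚ (sidePairing i))) := by
    refine FreeGroup.injective_lift_of_ping_pong _ attracting repelling ?_ ?_ ?_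
      disjoint_attracting_repelling ?_ ?_
    · intro i
      fin_cases i
      · exact ⟨_, cuspAct_γ_mem_attracting (c := OnePoint.infty)
          (fun ⟨q, h, _⟩ => OnePoint.infty_ne_coe q h)⟩
      · exact ⟨_, cuspAct_δ_mem_attracting (c := OnePoint.infty)
          (fun ⟨q, h, _⟩ => OnePoint.infty_ne_coe q h)⟩
    · intro i j hij
      fin_cases i <;> fin_cases j
      · exact absurd rfl hij
      · exact disjoint_attracting
      · exact disjoint_attracting.symm
      · exact absurd rfl hij
    · intro i j hij
      fin_cases i <;> fin_cases j
      · exact absurd rfl hij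
      · exact disjoint_repelling
      · exact disjoint_repelling.symm
      · exact absurd rfl hij
    · intro i
      fin_cases i
      · rintro _ ⟨c, hc, rfl⟩
        exact Set.mem_of_eq_of_mem (h0 c) (cuspAct_γ_mem_attracting hc)
      · rintro _ ⟨c, hc, rfl⟩
        exact Set.mem_of_eq_of_mem (h1 c) (cuspAct_δ_mem_attracting hc)
    · intro i
      fin_cases i
      · rintro _ ⟨c, hc, rfl⟩
        exact Set.mem_of_eq_of_mem (h0' c) (cuspAct_γ_inv_mem_repelling hc)
      · rintro _ ⟨c, hc, rfl⟩
        exact Set.mem_of_eq_of_mem (h1' c) (cuspAct_δ_inv_mem_repelling hc)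
  rw [hcomp, MonoidHom.coe_comp] at hinj
  exact hinj.of_comp

/-- The stabilizer of the cusp `∞` centralizes the peripheral element. -/
theorem mul_peripheral_of_fix {g : Gamma11} (hg : cuspAct g OnePoint.infty = OnePoint.infty) :
    g * peripheral = peripheral * g := by
  -- Faithfulness reduces the claim to integer matrices, where the stabilizer of `∞` consists of
  -- translations up to sign, and these commute.
  apply holonomy_injective
  have h10 : holonomy g 1 0 = 0 := by
    rw [cuspAct_eq, Cusp.move_infty] at hg
    by_contra h
    rw [if_neg h] at hg
    exact OnePoint.coe_ne_infty _ hg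
  have hdet := (holonomy g).det_coe
  rw [Matrix.det_fin_two, h10, mul_zero, sub_zero] at hdet
  have hdiag : holonomy g 0 0 = holonomy g 1 1 := by
    rcases Int.mul_eq_one_iff_eq_one_or_neg_one.1 hdet with h | h <;> rw [h.1, h.2]
  rw [map_mul, map_mul]
  apply Subtype.ext
  rw [Matrix.SpecialLinearGroup.coe_mul, Matrix.SpecialLinearGroup.coe_mul, holonomy_peripheral,
    Matrix.eta_fin_two (holonomy g : Matrix (Fin 2) (Fin 2) ℤ), h10, hdiag]
  ext i j
  fin_cases i <;> fin_cases j <;> simp [Matrix.mul_apply, Fin.sum_univ_two]; ring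

end Gamma11

/-! ### Flags and frames -/

namespace FullFlag

theorem eq_of_isFrame {A B : FullFlag} {u v : Fin 3 → ℝ} (hA : A.IsFrame u v)
    (hB : B.IsFrame u v) : A = B := by
  have h1 : A.line = B.line := hA.1.trans hB.1.symm
  have h2 : A.plane = B.plane := hA.2.trans hB.2.symm
  cases A
  cases B
  simp only at h1 h2
  subst h1 h2
  rfl

theorem IsFrame.of_change {A : FullFlag} {u v : Fin 3 → ℝ} (h : A.IsFrame u v) {a b c : ℝ}
    (ha : a ≠ 0) (hc : c ≠ 0) : A.IsFrame (a • u) (b • u + c • v) := by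
  refine ⟨?_, ?_⟩
  · rw [h.1, Submodule.span_singleton_smul_eq (IsUnit.mk0 a ha)]
  · rw [h.2]
    apply le_antisymm
    · rw [Submodule.span_le]
      rintro w (rfl | rfl)
      · exact Submodule.mem_span_pair.2 ⟨a⁻¹, 0, by simp [smul_smul, ha]⟩
      · refine Submodule.mem_span_pair.2 ⟨-(c⁻¹ * b * a⁻¹), c⁻¹, ?_⟩
        simp only [smul_add, smul_smul]
        rw [mul_assoc, neg_mul, mul_assoc, inv_mul_cancel₀ hc, mul_assoc, inv_mul_cancel₀ ha]
        simp
    · rw [Submodule.span_le]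
      rintro w (rfl | rfl)
      · exact Submodule.mem_span_pair.2 ⟨a, 0, by simp⟩
      · exact Submodule.mem_span_pair.2 ⟨b, c, rfl⟩

theorem IsFrame.map {A : FullFlag} {u v : Fin 3 → ℝ} (h : A.IsFrame u v)
    (e : (Fin 3 → ℝ) ≃ₗ[ℝ] (Fin 3 → ℝ)) : (A.map e).IsFrame (e u) (e v) := by
  refine ⟨?_, ?_⟩
  · simp [FullFlag.map, h.1, Submodule.map_span]
  · simp [FullFlag.map, h.2, Submodule.map_span, Set.image_pair]

theorem map_trans (e f : (Fin 3 → ℝ) ≃ₗ[ℝ] (Fin 3 → ℝ)) (A : FullFlag) :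
    A.map (f * e) = (A.map e).map f :=
  eq_of_isFrame (A.isFrame_vec.map _) ((A.isFrame_vec.map e).map f)

theorem map_one (A : FullFlag) : A.map 1 = A :=
  eq_of_isFrame (A.isFrame_vec.map _) A.isFrame_vec

/-- The image of a flag under a matrix of determinant one. -/
noncomputable def act (M : SL(3, ℝ)) (A : FullFlag) : FullFlag :=
  A.map (Matrix.SpecialLinearGroup.toLin' M)

theorem act_mul (M N : SL(3, ℝ)) (A : FullFlag) : act (M * N) A = act M (act N A) := by
  rw [act, map_mul, map_trans]; rfl

theorem act_one (A : FullFlag) : act 1 A = A := by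
  rw [act, _root_.map_one, map_one]

theorem IsFrame.act {A : FullFlag} {u v : Fin 3 → ℝ} (h : A.IsFrame u v) (M : SL(3, ℝ)) :
    (FullFlag.act M A).IsFrame (M.1.mulVec u) (M.1.mulVec v) := h.map _

theorem wedge3_mulVec (M : SL(3, ℝ)) (u v w : Fin 3 → ℝ) :
    wedge3 (M.1.mulVec u) (M.1.mulVec v) (M.1.mulVec w) = wedge3 u v w := by
  have h : Matrix.of ![M.1.mulVec u, M.1.mulVec v, M.1.mulVec w] =
      Matrix.of ![u, v, w] * M.1.transpose := by
    ext i j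
    fin_cases i <;>
      simp [Matrix.mul_apply, Matrix.mulVec, dotProduct, Fin.sum_univ_three, mul_comm]
  rw [wedge3, h, Matrix.det_mul, Matrix.det_transpose, M.2, mul_one, wedge3]

theorem tripleRatio_act (M : SL(3, ℝ)) (A B C : FullFlag) :
    tripleRatio (act M A) (act M B) (act M C) = tripleRatio A B C := by
  rw [tripleRatio_eq (A.isFrame_vec.act M) (B.isFrame_vec.act M) (C.isFrame_vec.act M)]
  simp only [wedge3_mulVec, tripleRatio]

theorem pcrAt_act (M : SL(3, ℝ)) (A B C D : FullFlag) :
    pcrAt (act M A) (act M B) (act M C) (act M D) = pcrAt A B C D := by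
  rw [pcrAt_eq (A.isFrame_vec.act M) (B.isFrame_vec.act M) (C.isFrame_vec.act M)
    (D.isFrame_vec.act M)]
  simp only [wedge3_mulVec, pcrAt]

theorem isPositiveQuadruple_act (M : SL(3, ℝ)) (A B C D : FullFlag) :
    IsPositiveQuadruple (act M A) (act M B) (act M C) (act M D) ↔ IsPositiveQuadruple A B C D := by
  simp only [IsPositiveQuadruple, tripleRatio_act, pcrAt_act]

/-- The standard flag, spanned by the first basis vectors. -/
noncomputable def std : FullFlag where
  line := Submodule.span ℝ {![1, 0, 0]}
  plane := Submodule.span ℝ {![1, 0, 0], ![0, 1, 0]}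
  finrank_line := finrank_span_singleton fun h => by simpa using congrFun h 0
  finrank_plane := by
    have h : LinearIndependent ℝ ![(![1, 0, 0] : Fin 3 → ℝ), ![0, 1, 0]] := by
      rw [LinearIndependent.pair_iff]
      intro s t h
      exact ⟨by simpa using congrFun h 0, by simpa using congrFun h 1⟩
    have := finrank_span_eq_card h
    rwa [Matrix.range_cons_cons_empty, Fintype.card_fin] at this
  line_le_plane := Submodule.span_mono (by simp)

theorem isFrame_std : std.IsFrame ![1, 0, 0] ![0, 1, 0] := ⟨rfl, rfl⟩

theorem isFrame_act_std (M : SL(3, ℝ)) :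
    (act M std).IsFrame ![M 0 0, M 1 0, M 2 0] ![M 0 1, M 1 1, M 2 1] := by
  have h := isFrame_std.act M
  have h0 : M.1.mulVec ![1, 0, 0] = ![M 0 0, M 1 0, M 2 0] := by
    ext i; fin_cases i <;> simp [Matrix.mulVec, dotProduct, Fin.sum_univ_three]
  have h1 : M.1.mulVec ![0, 1, 0] = ![M 0 1, M 1 1, M 2 1] := by
    ext i; fin_cases i <;> simp [Matrix.mulVec, dotProduct, Fin.sum_univ_three]
  rwa [h0, h1] at h

theorem act_std_of_upper {M : SL(3, ℝ)} (h10 : M 1 0 = 0) (h20 : M 2 0 = 0) (h21 : M 2 1 = 0) :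
    act M std = std := by
  have hdet := M.det_coe
  rw [Matrix.det_fin_three, h10, h20, h21] at hdet
  have h00 : M 0 0 ≠ 0 := fun h => by simp [h] at hdet
  have h11 : M 1 1 ≠ 0 := fun h => by simp [h] at hdet
  refine eq_of_isFrame (isFrame_act_std M) ?_
  have := isFrame_std.of_change (b := M 0 1) h00 h11
  have e0 : (M 0 0 • ![1, 0, 0] : Fin 3 → ℝ) = ![M 0 0, M 1 0, M 2 0] := by
    ext i; fin_cases i <;> simp [h10, h20]
  have e1 : (M 0 1 • ![1, 0, 0] + M 1 1 • ![0, 1, 0] : Fin 3 → ℝ) = ![M 0 1, M 1 1, M 2 1] := by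
    ext i; fin_cases i <;> simp [h21]
  rwa [e0, e1] at this

end FullFlag

/-! ### The representations -/

namespace Gamma11

open FullFlag

/-- The linear map that realizes `z ↦ z + 1` on the framings; the parameter is the cube root of
the triple ratio. -/
noncomputable def upperStep (u : ℝˣ) : SL(3, ℝ) :=
  ⟨!![(u : ℝ)⁻¹ ^ 2, (u : ℝ)⁻¹ ^ 2 + u, u; 0, u, u; 0, 0, u], by
    simp [Matrix.det_fin_three]; field_simp⟩

/-- The linear map that realizes `z ↦ z / (z + 1)` on the framings. -/
noncomputable def lowerStep (u : ℝˣ) : SL(3, ℝ) :=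
  ⟨!![(u : ℝ)⁻¹, 0, 0; (u : ℝ)⁻¹, (u : ℝ)⁻¹, 0; (u : ℝ)⁻¹, (u : ℝ)⁻¹ + u ^ 2, u ^ 2], by
    simp [Matrix.det_fin_three]; field_simp⟩

theorem coe_upperStep (u : ℝˣ) : (upperStep u : Matrix (Fin 3) (Fin 3) ℝ) =
    !![(u : ℝ)⁻¹ ^ 2, (u : ℝ)⁻¹ ^ 2 + u, u; 0, u, u; 0, 0, u] := rfl

theorem coe_lowerStep (u : ℝˣ) : (lowerStep u : Matrix (Fin 3) (Fin 3) ℝ) =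
    !![(u : ℝ)⁻¹, 0, 0; (u : ℝ)⁻¹, (u : ℝ)⁻¹, 0; (u : ℝ)⁻¹, (u : ℝ)⁻¹ + u ^ 2, u ^ 2] := rfl

theorem coe_upperStep_inv (u : ℝˣ) : (((upperStep u)⁻¹ : SL(3, ℝ)) : Matrix (Fin 3) (Fin 3) ℝ) =
    !![(u : ℝ) ^ 2, -((u : ℝ)⁻¹ + u ^ 2), (u : ℝ)⁻¹; 0, (u : ℝ)⁻¹, -(u : ℝ)⁻¹; 0, 0, (u : ℝ)⁻¹] := by
  rw [Matrix.SpecialLinearGroup.coe_inv, coe_upperStep, Matrix.adjugate_fin_three_of]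
  ext i j
  fin_cases i <;> fin_cases j <;> simp <;> field_simp <;> ring

theorem coe_lowerStep_inv (u : ℝˣ) : (((lowerStep u)⁻¹ : SL(3, ℝ)) : Matrix (Fin 3) (Fin 3) ℝ) =
    !![(u : ℝ), 0, 0; -(u : ℝ), u, 0; u, -(u + (u : ℝ)⁻¹ ^ 2), (u : ℝ)⁻¹ ^ 2] := by
  rw [Matrix.SpecialLinearGroup.coe_inv, coe_lowerStep, Matrix.adjugate_fin_three_of]
  ext i j
  fin_cases i <;> fin_cases j <;> simp <;> field_simp <;> ring

/-- This is the modular relation `T L⁻¹ T = L⁻¹ T L⁻¹` in twisted form. Each letter exchanges `u`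
and `u⁻¹`, and `L⁻¹` read at parameter `u` becomes `(lowerStep u⁻¹)⁻¹`. -/
theorem braid_relation (u : ℝˣ) :
    upperStep u * (lowerStep u)⁻¹ * upperStep u =
      (lowerStep u⁻¹)⁻¹ * upperStep u⁻¹ * (lowerStep u⁻¹)⁻¹ := by
  apply Subtype.ext
  simp only [Matrix.SpecialLinearGroup.coe_mul, coe_upperStep, coe_lowerStep_inv]
  ext i j
  fin_cases i <;> fin_cases j <;>
    simp [Matrix.mul_apply, Fin.sum_univ_three] <;> field_simp <;> ring

/-- The family of representations into `SL(3, ℝ)`. -/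
noncomputable def rep (u : ℝˣ) : Gamma11 →* SL(3, ℝ) :=
  FreeGroup.lift ![upperStep u * lowerStep u⁻¹, (upperStep u⁻¹)⁻¹ * (lowerStep u)⁻¹]

theorem rep_γ (u : ℝˣ) : rep u γ = upperStep u * lowerStep u⁻¹ := by
  simp only [rep, γ, FreeGroup.lift_apply_of]; rfl

theorem rep_δ (u : ℝˣ) : rep u δ = (upperStep u⁻¹)⁻¹ * (lowerStep u)⁻¹ := by
  simp only [rep, δ, FreeGroup.lift_apply_of]; rfl

/-- Conjugation by `z ↦ z + 1`. -/
def upperConj : Gamma11 →* Gamma11 := FreeGroup.lift ![γ * δ, γ⁻¹]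

/-- Conjugation by `z ↦ z / (z + 1)`. -/
def lowerConj : Gamma11 →* Gamma11 := FreeGroup.lift ![δ⁻¹, γ * δ]

theorem upperConj_γ : upperConj γ = γ * δ := by
  simp only [upperConj, γ, FreeGroup.lift_apply_of]; rfl

theorem upperConj_δ : upperConj δ = γ⁻¹ := by
  simp only [upperConj, δ, FreeGroup.lift_apply_of]; rfl

theorem lowerConj_γ : lowerConj γ = δ⁻¹ := by
  simp only [lowerConj, γ, FreeGroup.lift_apply_of]; rfl

theorem lowerConj_δ : lowerConj δ = γ * δ := by
  simp only [lowerConj, δ, FreeGroup.lift_apply_of]; rfl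

theorem holonomy_upperConj (g : Gamma11) :
    holonomy (upperConj g) = upperShear * holonomy g * upperShear⁻¹ := by
  have : holonomy.comp upperConj = (MulAut.conj upperShear).toMonoidHom.comp holonomy := by
    apply hom_ext
    · simp only [MonoidHom.comp_apply, upperConj_γ, map_mul, holonomy_γ, holonomy_δ]
      decide +kernel
    · simp only [MonoidHom.comp_apply, upperConj_δ, map_inv, holonomy_γ, holonomy_δ]
      decide +kernel
  exact DFunLike.congr_fun this g

theorem holonomy_lowerConj (g : Gamma11) :
    holonomy (lowerConj g) = lowerShear * holonomy g * lowerShear⁻¹ := by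
  have : holonomy.comp lowerConj = (MulAut.conj lowerShear).toMonoidHom.comp holonomy := by
    apply hom_ext
    · simp only [MonoidHom.comp_apply, lowerConj_γ, map_inv, holonomy_γ, holonomy_δ]
      decide +kernel
    · simp only [MonoidHom.comp_apply, lowerConj_δ, map_mul, holonomy_γ, holonomy_δ]
      decide +kernel
  exact DFunLike.congr_fun this g

/-- The twisted form of `T L T⁻¹ L⁻¹ = T T L T⁻¹`, a consequence of the braid relation; it is the
value needed on one generator in `rep_upperConj`. -/
theorem rep_γ_mul_δ (u : ℝˣ) :
    rep u (γ * δ) = upperStep u * upperStep u⁻¹ * lowerStep u * (upperStep u)⁻¹ := by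
  have h := braid_relation u⁻¹
  rw [inv_inv] at h
  have h2 : lowerStep u * upperStep u⁻¹ * (lowerStep u⁻¹)⁻¹ =
      upperStep u * (lowerStep u)⁻¹ * (upperStep u⁻¹)⁻¹ := by
    rw [eq_mul_inv_iff_mul_eq, mul_assoc, mul_assoc, ← mul_assoc (upperStep u⁻¹), h]
    group
  have h3 : lowerStep u⁻¹ * (upperStep u⁻¹)⁻¹ * (lowerStep u)⁻¹ =
      upperStep u⁻¹ * lowerStep u * (upperStep u)⁻¹ := by
    have := congrArg (fun x => x⁻¹) h2
    simpa [mul_assoc] using this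
  rw [map_mul, rep_γ, rep_δ, mul_assoc, ← mul_assoc (lowerStep u⁻¹), h3]
  simp only [mul_assoc]

/-- Conjugation by `T` is an outer symmetry that exchanges the parameters `u` and `u⁻¹`. Together
with `rep_lowerConj` it extends the equivariance of the framing from the torus group to the modular
group. -/
theorem rep_upperConj (u : ℝˣ) (g : Gamma11) :
    rep u (upperConj g) = upperStep u * rep u⁻¹ g * (upperStep u)⁻¹ := by
  have : (rep u).comp upperConj = (MulAut.conj (upperStep u)).toMonoidHom.comp (rep u⁻¹) := by
    apply hom_ext
    · simp [MonoidHom.comp_apply, upperConj_γ, rep_γ_mul_δ, rep_γ, mul_assoc, - map_mul]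
    · simp [MonoidHom.comp_apply, upperConj_δ, rep_γ, rep_δ]
  exact DFunLike.congr_fun this g

theorem rep_lowerConj (u : ℝˣ) (g : Gamma11) :
    rep u (lowerConj g) = lowerStep u * rep u⁻¹ g * (lowerStep u)⁻¹ := by
  have h := braid_relation u
  have : (rep u).comp lowerConj = (MulAut.conj (lowerStep u)).toMonoidHom.comp (rep u⁻¹) := by
    apply hom_ext
    · simp [MonoidHom.comp_apply, lowerConj_γ, rep_γ, rep_δ, mul_assoc]
    · simp only [MonoidHom.comp_apply, lowerConj_δ, map_mul, rep_γ, rep_δ, inv_inv,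
        MulEquiv.coe_toMonoidHom, MulAut.conj_apply]
      have h4 : upperStep u⁻¹ =
          lowerStep u⁻¹ * (upperStep u * (lowerStep u)⁻¹ * upperStep u) * lowerStep u⁻¹ := by
        rw [h]; group
      have h5 : upperStep u * lowerStep u⁻¹ * (upperStep u⁻¹)⁻¹ =
          lowerStep u * (upperStep u)⁻¹ * (lowerStep u⁻¹)⁻¹ := by
        rw [h4]; group
      rw [← mul_assoc, h5]
      simp only [mul_assoc, inv_mul_cancel_left]
  exact DFunLike.congr_fun this g

/-! ### Explicit matrices -/

theorem coe_rep_γ (u : ℝˣ) : (rep u γ : Matrix (Fin 3) (Fin 3) ℝ) =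
    !![2 * (u : ℝ)⁻¹ + 2 * u ^ 2, 2 * (u : ℝ)⁻¹ + 2 * u ^ 2, (u : ℝ)⁻¹;
      2 * u ^ 2, 2 * u ^ 2 + (u : ℝ)⁻¹, (u : ℝ)⁻¹; u ^ 2, u ^ 2 + (u : ℝ)⁻¹, (u : ℝ)⁻¹] := by
  rw [rep_γ, Matrix.SpecialLinearGroup.coe_mul, coe_upperStep, coe_lowerStep]
  ext i j
  fin_cases i <;> fin_cases j <;>
    simp [Matrix.mul_apply, Fin.sum_univ_three] <;> field_simp <;> ring

theorem coe_rep_δ (u : ℝˣ) : (rep u δ : Matrix (Fin 3) (Fin 3) ℝ) =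
    !![2 * (u : ℝ)⁻¹ + 2 * u ^ 2, -(2 * (u : ℝ)⁻¹ + 2 * u ^ 2), (u : ℝ)⁻¹;
      -(2 * u ^ 2), 2 * u ^ 2 + (u : ℝ)⁻¹, -(u : ℝ)⁻¹;
      u ^ 2, -(u ^ 2 + (u : ℝ)⁻¹), (u : ℝ)⁻¹] := by
  rw [rep_δ, Matrix.SpecialLinearGroup.coe_mul, coe_upperStep_inv, coe_lowerStep_inv]
  ext i j
  fin_cases i <;> fin_cases j <;>
    simp [Matrix.mul_apply, Fin.sum_univ_three] <;> field_simp <;> ring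

theorem coe_rep_γ_inv (u : ℝˣ) : (rep u γ⁻¹ : Matrix (Fin 3) (Fin 3) ℝ) =
    !![(u : ℝ), -((u : ℝ)⁻¹ ^ 2 + u), (u : ℝ)⁻¹ ^ 2;
      -(u : ℝ), 2 * (u : ℝ)⁻¹ ^ 2 + u, -(2 * (u : ℝ)⁻¹ ^ 2);
      u, -(2 * (u : ℝ)⁻¹ ^ 2 + 2 * u), 2 * (u : ℝ)⁻¹ ^ 2 + 2 * u] := by
  rw [map_inv, rep_γ, mul_inv_rev, Matrix.SpecialLinearGroup.coe_mul, coe_upperStep_inv,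
    coe_lowerStep_inv]
  ext i j
  fin_cases i <;> fin_cases j <;>
    simp [Matrix.mul_apply, Fin.sum_univ_three] <;> field_simp <;> ring

theorem coe_rep_δ_inv (u : ℝˣ) : (rep u δ⁻¹ : Matrix (Fin 3) (Fin 3) ℝ) =
    !![(u : ℝ), (u : ℝ)⁻¹ ^ 2 + u, (u : ℝ)⁻¹ ^ 2;
      u, 2 * (u : ℝ)⁻¹ ^ 2 + u, 2 * (u : ℝ)⁻¹ ^ 2;
      u, 2 * (u : ℝ)⁻¹ ^ 2 + 2 * u, 2 * (u : ℝ)⁻¹ ^ 2 + 2 * u] := by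
  rw [map_inv, rep_δ, mul_inv_rev, inv_inv, inv_inv, Matrix.SpecialLinearGroup.coe_mul,
    coe_upperStep, coe_lowerStep]
  ext i j
  fin_cases i <;> fin_cases j <;>
    simp [Matrix.mul_apply, Fin.sum_univ_three] <;> field_simp <;> ring

theorem coe_rep_γ_inv_mul_δ_inv (u : ℝˣ) :
    ((rep u γ⁻¹ * rep u δ⁻¹ : SL(3, ℝ)) : Matrix (Fin 3) (Fin 3) ℝ) =
      !![0, 0, (u : ℝ)⁻¹; 0, -(u : ℝ)⁻¹, -(3 * (u : ℝ)⁻¹);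
        u ^ 2, 3 * (u : ℝ)⁻¹ + 3 * u ^ 2, 5 * (u : ℝ)⁻¹ + 4 * u ^ 2] := by
  rw [Matrix.SpecialLinearGroup.coe_mul, coe_rep_γ_inv, coe_rep_δ_inv]
  ext i j
  fin_cases i <;> fin_cases j <;>
    simp [Matrix.mul_apply, Fin.sum_univ_three] <;> field_simp <;> ring

/-- The matrix is unipotent, and for `u > 0` its superdiagonal entries are nonzero. It is thus a
single Jordan block, and the standard flag is its only invariant full flag. -/
theorem rep_peripheral (u : ℝˣ) : (rep u peripheral : Matrix (Fin 3) (Fin 3) ℝ) =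
    !![1, 6 * ((u : ℝ)⁻¹ ^ 3 + 1), 18 * ((u : ℝ)⁻¹ ^ 3 + 1); 0, 1, 6; 0, 0, 1] := by
  have h1 : rep u peripheral = rep u γ * rep u δ * (rep u γ⁻¹ * rep u δ⁻¹) := by
    simp only [peripheral, map_mul, mul_assoc]
  have h2 : ((rep u γ * rep u δ : SL(3, ℝ)) : Matrix (Fin 3) (Fin 3) ℝ) =
      !![4 * (u : ℝ)⁻¹ ^ 2 + 5 * u, -(3 * (u : ℝ)⁻¹ ^ 2 + 3 * u), (u : ℝ)⁻¹ ^ 2;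
        3 * u, -u, 0; u, 0, 0] := by
    rw [Matrix.SpecialLinearGroup.coe_mul, coe_rep_γ, coe_rep_δ]
    ext i j
    fin_cases i <;> fin_cases j <;>
      simp [Matrix.mul_apply, Fin.sum_univ_three] <;> field_simp <;> ring
  rw [h1, Matrix.SpecialLinearGroup.coe_mul, h2, coe_rep_γ_inv_mul_δ_inv]
  ext i j
  fin_cases i <;> fin_cases j <;>
    simp [Matrix.mul_apply, Fin.sum_univ_three] <;> field_simp <;> ring

/-- Only the stabilizer of the standard flag commutes with the peripheral element. -/
theorem act_std_of_commute {u : ℝˣ} (hu : 0 < (u : ℝ)) {M : SL(3, ℝ)}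
    (h : M * rep u peripheral = rep u peripheral * M) : act M std = std := by
  have h' := congrArg (fun N : SL(3, ℝ) => (N : Matrix (Fin 3) (Fin 3) ℝ)) h
  simp only [Matrix.SpecialLinearGroup.coe_mul, rep_peripheral] at h'
  have hk : 6 * ((u : ℝ)⁻¹ ^ 3 + 1) ≠ 0 := by positivity
  have e := fun i j => congrFun (congrFun h' i) j
  have e10 := e 1 0
  have e00 := e 0 0
  have e11 := e 1 1
  simp [Matrix.mul_apply, Fin.sum_univ_three] at e10 e00 e11
  have e20 : M 2 0 = 0 := e10
  have e10 : M 1 0 = 0 := by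
    rw [e20] at e00
    have : 6 * ((u : ℝ)⁻¹ ^ 3 + 1) * M 1 0 = 0 := by rw [inv_pow]; linarith
    exact (mul_eq_zero.1 this).resolve_left hk
  refine act_std_of_upper e10 e20 ?_
  rw [e10] at e11
  linarith

/-! ### The equivariant framing -/

/-- An element of the group that maps `∞` to a given cusp. -/
noncomputable def moveInfty (c : Cusp) : Gamma11 := (exists_cuspAct_infty c).choose

theorem cuspAct_moveInfty (c : Cusp) : cuspAct (moveInfty c) OnePoint.infty = c :=
  (exists_cuspAct_infty c).choose_spec

/-- The framing of the representation `rep u`. -/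
noncomputable def framing (u : ℝˣ) (c : Cusp) : FullFlag := act (rep u (moveInfty c)) std

/-- The flag does not depend on the element chosen to reach the cusp: two choices differ by a
stabilizer of `∞`, which commutes with `peripheral` and so fixes the standard flag. -/
theorem framing_cuspAct_infty {u : ℝˣ} (hu : 0 < (u : ℝ)) (g : Gamma11) :
    framing u (cuspAct g OnePoint.infty) = act (rep u g) std := by
  set c := cuspAct g OnePoint.infty with hc
  have hfix : cuspAct (g⁻¹ * moveInfty c) OnePoint.infty = OnePoint.infty := by
    rw [cuspAct_mul, cuspAct_moveInfty, cuspAct_inv_eq_iff]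
  have h := act_std_of_commute (u := u) (M := rep u (g⁻¹ * moveInfty c)) hu
    (by rw [← map_mul, ← map_mul, mul_peripheral_of_fix hfix])
  calc framing u c = act (rep u (g * (g⁻¹ * moveInfty c))) std := by
        rw [mul_inv_cancel_left]; rfl
    _ = act (rep u g) std := by rw [map_mul, act_mul, h]

theorem framing_infty {u : ℝˣ} (hu : 0 < (u : ℝ)) : framing u OnePoint.infty = std := by
  have := framing_cuspAct_infty hu 1
  rwa [cuspAct_one, _root_.map_one, act_one] at this

theorem framing_cuspAct {u : ℝˣ} (hu : 0 < (u : ℝ)) (g : Gamma11) (c : Cusp) :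
    framing u (cuspAct g c) = act (rep u g) (framing u c) := by
  obtain ⟨h, rfl⟩ := exists_cuspAct_infty c
  rw [← cuspAct_mul, framing_cuspAct_infty hu, framing_cuspAct_infty hu, map_mul, act_mul]

theorem inv_pos_unit {u : ℝˣ} (hu : 0 < (u : ℝ)) : 0 < ((u⁻¹ : ℝˣ) : ℝ) := by
  rw [Units.val_inv_eq_inv_val]; positivity

theorem framing_upperShear {u : ℝˣ} (hu : 0 < (u : ℝ)) (c : Cusp) :
    framing u (Cusp.move upperShear c) = act (upperStep u) (framing u⁻¹ c) := by
  obtain ⟨g, rfl⟩ := exists_cuspAct_infty c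
  have hfix : Cusp.move upperShear⁻¹ OnePoint.infty = OnePoint.infty := by
    simp [Cusp.move_infty, coe_upperShear, Matrix.adjugate_fin_two_of]
  have h : Cusp.move upperShear (cuspAct g OnePoint.infty) =
      cuspAct (upperConj g) OnePoint.infty := by
    rw [cuspAct_eq, cuspAct_eq, holonomy_upperConj, Cusp.move_mul, Cusp.move_mul, hfix]
  rw [h, framing_cuspAct_infty hu, framing_cuspAct_infty (inv_pos_unit hu), rep_upperConj,
    act_mul, act_mul, act_std_of_upper (M := (upperStep u)⁻¹)] <;> rw [coe_upperStep_inv] <;> rfl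

theorem framing_lowerShear {u : ℝˣ} (hu : 0 < (u : ℝ)) (c : Cusp) :
    framing u (Cusp.move lowerShear c) = act (lowerStep u) (framing u⁻¹ c) := by
  obtain ⟨g, rfl⟩ := exists_cuspAct_infty c
  -- Unlike `T`, the map `L` moves `∞`. Since `δ⁻¹ = L T` and `T` fixes `∞`, the element `δ⁻¹` has
  -- the same effect as `L` there.
  have hdet : lowerShear⁻¹ * holonomy δ⁻¹ = upperShear := by
    rw [map_inv, holonomy_δ, matδ_eq]; group
  have hfix : Cusp.move upperShear OnePoint.infty = OnePoint.infty := by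
    simp [Cusp.move_infty, coe_upperShear]
  have h : Cusp.move lowerShear (cuspAct g OnePoint.infty) =
      cuspAct (lowerConj g * δ⁻¹) OnePoint.infty := by
    rw [cuspAct_eq, cuspAct_eq, map_mul, holonomy_lowerConj, mul_assoc, hdet, Cusp.move_mul,
      Cusp.move_mul, hfix]
  have hrep : rep u (lowerConj g * δ⁻¹) = lowerStep u * (rep u⁻¹ g * upperStep u⁻¹) := by
    rw [map_mul, rep_lowerConj, map_inv, rep_δ]; group
  rw [h, framing_cuspAct_infty hu, framing_cuspAct_infty (inv_pos_unit hu), hrep,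
    act_mul, act_mul, act_std_of_upper (M := upperStep u⁻¹)] <;> rfl

end Gamma11

/-! ### Flags in an affine chart -/

namespace FullFlag

/-- In the affine chart of `ℙ²` in which the standard flag is the vertical point on the line at
infinity, the flag is the point `(X, Y)` together with the line of slope `s` through it. -/
def IsAffine (F : FullFlag) (X Y s : ℝ) : Prop := F.IsFrame ![Y, X, 1] ![s, 1, 0]

theorem IsAffine.unique {F : FullFlag} {X Y s X' Y' s' : ℝ} (h : F.IsAffine X Y s)
    (h' : F.IsAffine X' Y' s') : X = X' ∧ Y = Y' ∧ s = s' := by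
  obtain ⟨a, b, c, -, -, h1, h2⟩ := IsFrame.change h h'
  have e : ∀ i, ![Y', X', 1] i = (a • ![Y, X, 1]) i := fun i => congrFun h1 i
  have f : ∀ i, ![s', 1, 0] i = (b • ![Y, X, 1] + c • ![s, 1, 0]) i := fun i => congrFun h2 i
  have e0 := e 0
  have e1 := e 1
  have e2 := e 2
  have f0 := f 0
  have f1 := f 1
  have f2 := f 2
  simp at e0 e1 e2 f0 f1 f2
  subst e2 f2
  simp at e0 e1 f0 f1
  subst f1
  simp at f0
  exact ⟨e1.symm, e0.symm, f0.symm⟩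

theorem IsFrame.isAffine {F : FullFlag} {p₀ p₁ p₂ r₀ r₁ r₂ : ℝ}
    (h : F.IsFrame ![p₀, p₁, p₂] ![r₀, r₁, r₂]) (hp : p₂ ≠ 0) (hm : r₁ * p₂ - p₁ * r₂ ≠ 0) :
    F.IsAffine (p₁ / p₂) (p₀ / p₂) ((r₀ * p₂ - p₀ * r₂) / (r₁ * p₂ - p₁ * r₂)) := by
  have := h.of_change (a := p₂⁻¹) (b := -(r₂ / (r₁ * p₂ - p₁ * r₂)))
    (c := p₂ / (r₁ * p₂ - p₁ * r₂)) (inv_ne_zero hp) (div_ne_zero hp hm)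
  have e0 : p₂⁻¹ • ![p₀, p₁, p₂] = ![p₀ / p₂, p₁ / p₂, 1] := by
    ext i; fin_cases i <;> simp [div_eq_inv_mul, hp]
  have e1 : -(r₂ / (r₁ * p₂ - p₁ * r₂)) • ![p₀, p₁, p₂] +
      (p₂ / (r₁ * p₂ - p₁ * r₂)) • ![r₀, r₁, r₂] =
        ![(r₀ * p₂ - p₀ * r₂) / (r₁ * p₂ - p₁ * r₂), 1, 0] := by
    ext i
    fin_cases i
    · simp; ring
    · simp only [Fin.mk_one, Pi.add_apply, Pi.smul_apply, smul_eq_mul, Matrix.cons_val_one,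
        Matrix.cons_val_zero]
      have : -(r₂ / (r₁ * p₂ - p₁ * r₂)) * p₁ + p₂ / (r₁ * p₂ - p₁ * r₂) * r₁ =
          (r₁ * p₂ - p₁ * r₂) / (r₁ * p₂ - p₁ * r₂) := by ring
      rw [this, div_self hm]
    · simp; ring
  rwa [e0, e1] at this

/-- The two flags are, from left to right, points on the graph of a strictly convex function,
together with lines of support. -/
def Convex (F G : FullFlag) : Prop :=
  ∃ X Y s X' Y' s' : ℝ, F.IsAffine X Y s ∧ G.IsAffine X' Y' s' ∧ X < X' ∧
    s * (X' - X) < Y' - Y ∧ Y' - Y < s' * (X' - X)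

/-- The slope of a chord lies strictly between the slopes of the lines at its ends, so the slopes
increase along the three flags, and the chord inequalities add up. -/
theorem Convex.trans {F G H : FullFlag} (h : F.Convex G) (h' : G.Convex H) : F.Convex H := by
  obtain ⟨X, Y, s, X', Y', s', hF, hG, hX, h1, h2⟩ := h
  obtain ⟨X₁, Y₁, s₁, X'', Y'', s'', hG', hH, hX', h1', h2'⟩ := h'
  obtain ⟨rfl, rfl, rfl⟩ := hG.unique hG'
  have hs : s < s' := lt_of_mul_lt_mul_right (h1.trans h2) (sub_pos.2 hX).le
  have hs' : s' < s'' := lt_of_mul_lt_mul_right (h1'.trans h2') (sub_pos.2 hX').le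
  refine ⟨X, Y, s, X'', Y'', s'', hF, hH, hX.trans hX', ?_, ?_⟩
  · have := mul_lt_mul_of_pos_right hs (sub_pos.2 hX')
    linarith
  · have := mul_lt_mul_of_pos_right hs' (sub_pos.2 hX)
    linarith

/-- In the chart every wedge product in the coordinates is, up to sign, `1`, a horizontal distance,
or the vertical gap between a point and a support line. -/
theorem isPositiveQuadruple_of_convex {F G H : FullFlag} (h : F.Convex G) (h' : G.Convex H) :
    IsPositiveQuadruple std F G H := by
  obtain ⟨X, Y, s, X', Y', s', hF, hG, hX, h1, h2⟩ := h
  obtain ⟨X₁, Y₁, s₁, X'', Y'', s'', hG', hH, hX', h1', h2'⟩ := h'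
  obtain ⟨rfl, rfl, rfl⟩ := hG.unique hG'
  rw [IsPositiveQuadruple, tripleRatio_eq isFrame_std hF hG, tripleRatio_eq isFrame_std hG hH,
    pcrAt_eq isFrame_std hF hG hH, pcrAt_eq hG hF isFrame_std hH]
  have a1 := sub_pos.2 hX
  have a2 := sub_pos.2 hX'
  have b1 := sub_pos.2 h1
  have b2 := sub_pos.2 h2
  have b3 := sub_pos.2 h1'
  have b4 := sub_pos.2 h2'
  have w1 : ∀ X Y, wedge3 ![1, 0, 0] ![0, 1, 0] ![Y, X, 1] = 1 := by
    intro X Y; simp [wedge3, Matrix.det_fin_three]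
  have w2 : ∀ X Y s, wedge3 ![Y, X, 1] ![s, 1, 0] ![1, 0, 0] = -1 := by
    intro X Y s; simp [wedge3, Matrix.det_fin_three]
  have w3 : ∀ X Y s X' Y', wedge3 ![Y, X, 1] ![s, 1, 0] ![Y', X', 1] =
      -(Y' - Y - s * (X' - X)) := by
    intro X Y s X' Y'; simp [wedge3, Matrix.det_fin_three]; ring
  have w4 : ∀ X Y X' Y', wedge3 ![1, 0, 0] ![Y, X, 1] ![Y', X', 1] = X - X' := by
    intro X Y X' Y'; simp [wedge3, Matrix.det_fin_three]
  have w5 : ∀ X Y X' Y', wedge3 ![Y, X, 1] ![1, 0, 0] ![Y', X', 1] = X' - X := by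
    intro X Y X' Y'; simp [wedge3, Matrix.det_fin_three]; ring
  simp only [w1, w2, w3, w4, w5]
  have c1 : -(Y - Y' - s' * (X - X')) = -(s' * (X' - X) - (Y' - Y)) := by ring
  have c2 : -(Y' - Y'' - s'' * (X' - X'')) = -(s'' * (X'' - X') - (Y'' - Y')) := by ring
  rw [c1, c2]
  refine ⟨?_, ?_, ?_, ?_⟩
  · simp only [div_one, one_mul, div_neg, neg_div, neg_neg]
    positivity
  · simp only [div_one, one_mul, div_neg, neg_div, neg_neg]
    positivity
  · rw [← neg_sub X'' X', div_neg, mul_neg, neg_neg]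
    positivity
  · rw [neg_div_neg_eq, ← neg_sub X' X, neg_div, mul_neg, neg_neg]
    positivity

end FullFlag

/-! ### Farey neighbours -/

/-- A transitive relation on `ℚ` that holds for Farey neighbours `q < r` holds whenever
`q < r`. -/
theorem Rat.rel_of_lt_of_farey {R : ℚ → ℚ → Prop} (trans : ∀ p q r, R p q → R q r → R p r)
    (farey : ∀ a b c d : ℤ, 0 < b → 0 < d → c * b - a * d = 1 → R (a / b) (c / d)) {q r : ℚ}
    (hqr : q < r) : R q r := by
  have key : ∀ n : ℕ, ∀ a b c d : ℤ, 0 < b → 0 < d → IsCoprime a b → IsCoprime c d →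
      0 < c * b - a * d → c * b - a * d ≤ n → R (a / b) (c / d) := by
    intro n
    induction n with
    | zero => intro a b c d _ _ _ _ h h'; exact absurd h (not_lt.2 (by simpa using h'))
    | succ n ih =>
      intro a b c d hb hd hab hcd hD hn
      obtain ⟨D, hDdef⟩ : ∃ D, D = c * b - a * d := ⟨_, rfl⟩
      rw [← hDdef] at hD hn
      rcases (show (1 : ℤ) ≤ D from hD).eq_or_lt with h1 | h1
      · exact farey a b c d hb hd (by rw [← hDdef, h1])
      -- Bézout gives a right Farey neighbour `e / f` of `a / b`. Adding multiples of `(a, b)` to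
      -- `(e, f)` reduces its determinant `i` against `c / d` modulo `D`, so that the pair `e / f`,
      -- `c / d` has smaller determinant.
      obtain ⟨x, y, hxy⟩ := hab
      obtain ⟨k, hk⟩ : ∃ k, k = (c * -x - y * d) / D := ⟨_, rfl⟩
      obtain ⟨e, he⟩ : ∃ e, e = y - k * a := ⟨_, rfl⟩
      obtain ⟨f, hf⟩ : ∃ f, f = -x - k * b := ⟨_, rfl⟩
      have hef : e * b - a * f = 1 := by rw [he, hf]; linear_combination hxy
      obtain ⟨i, hi⟩ : ∃ i, i = c * f - e * d := ⟨_, rfl⟩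
      have himod : i = (c * -x - y * d) % D := by
        rw [Int.emod_def, ← hk, hi, he, hf, hDdef]; ring
      have hi0 : 0 ≤ i := himod ▸ Int.emod_nonneg _ hD.ne'
      have hiD : i < D := himod ▸ Int.emod_lt_of_pos _ hD
      have hDf : D * f = i * b + d := by
        rw [hi, hDdef]; linear_combination d * hef
      have hfpos : 0 < f := by
        have : 0 < D * f := by rw [hDf]; positivity
        exact pos_of_mul_pos_right this hD.le
      -- If `i` vanished, `e / f` would equal `c / d`, which would force `D = 1`.
      have hine : i ≠ 0 := by
        intro h0
        have hdvd : d ∣ f := by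
          refine hcd.symm.dvd_of_dvd_mul_left ⟨e, ?_⟩
          linarith
        obtain ⟨t, rfl⟩ := hdvd
        have het : e = c * t := by
          have : d * (e - c * t) = 0 := by linarith
          linarith [(mul_eq_zero.1 this).resolve_left hd.ne']
        have hu : D * t = 1 := by rw [hDdef, ← hef, het]; ring
        exact absurd (Int.eq_one_of_mul_eq_one_right hD.le hu) h1.ne'
      have hcef : IsCoprime e f := ⟨b, -a, by linarith⟩
      exact trans _ _ _
        (farey a b e f hb hfpos hef)
        (ih e f c d hfpos hd hcef hcd (by rw [← hi]; omega) (by rw [← hi]; push_cast at hn; omega))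
  have hq := q.num_div_den
  have hr := r.num_div_den
  rw [← hq, ← hr]
  have hlt := hqr
  rw [Rat.lt_iff] at hlt
  exact key (r.num * q.den - q.num * r.den).toNat q.num q.den r.num r.den
    (by exact_mod_cast q.pos) (by exact_mod_cast r.pos) (Int.isCoprime_iff_gcd_eq_one.2 q.reduced)
    (Int.isCoprime_iff_gcd_eq_one.2 r.reduced) (by linarith) (Int.self_le_toNat _)

/-! ### Positivity of the framings -/

namespace Gamma11

open FullFlag

theorem isFrame_framing_zero {u : ℝˣ} (hu : 0 < (u : ℝ)) :
    (framing u ((0 : ℚ) : Cusp)).IsFrame ![0, 0, 1] ![0, 1, 0] := by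
  have h0 : cuspAct (γ⁻¹ * δ⁻¹) OnePoint.infty = ((0 : ℚ) : Cusp) := by
    rw [cuspAct_mul, cuspAct_δ_inv_infty, cuspAct_γ_inv_coe]
    norm_num
  have h := isFrame_act_std (rep u (γ⁻¹ * δ⁻¹))
  rw [← framing_cuspAct_infty hu, h0, map_mul, coe_rep_γ_inv_mul_δ_inv] at h
  have := h.of_change (a := (u : ℝ)⁻¹ ^ 2) (b := u * (3 * (u : ℝ)⁻¹ + 3 * u ^ 2) / u ^ 2)
    (c := -u) (by positivity) (neg_ne_zero.2 hu.ne')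
  convert this using 1
  · ext i; fin_cases i <;> simp
  · ext i; fin_cases i <;> simp

/-- The frame at a Farey edge, given by the columns of the matrix, is convex. -/
def IsConvexFrame (M : SL(3, ℝ)) : Prop :=
  (0 < M 2 0 ∧ 0 < M 2 1 ∧ 0 < M 2 2) ∧ 0 < M 1 0 * M 2 1 - M 1 1 * M 2 0 ∧
    0 < M 1 0 * M 2 2 - M 1 2 * M 2 0 ∧ 0 < M 1 1 * M 2 2 - M 1 2 * M 2 1

theorem isConvexFrame_lowerStep {u : ℝˣ} (hu : 0 < (u : ℝ)) : IsConvexFrame (lowerStep u) := by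
  simp only [IsConvexFrame, coe_lowerStep]
  refine ⟨⟨?_, ?_, ?_⟩, ?_, ?_, ?_⟩
  · convert (show 0 < (u : ℝ)⁻¹ by positivity) using 1
    simp
  · convert (show 0 < (u : ℝ)⁻¹ + u ^ 2 by positivity) using 1
    simp
  · convert (show 0 < (u : ℝ) ^ 2 by positivity) using 1
    simp
  · convert (show 0 < (u : ℝ)⁻¹ * u ^ 2 by positivity) using 1
    simp; ring
  · convert (show 0 < (u : ℝ)⁻¹ * u ^ 2 by positivity) using 1
    simp
  · convert (show 0 < (u : ℝ)⁻¹ * u ^ 2 by positivity) using 1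
    simp

/-- By Cauchy–Binet the new entries and minors are combinations of the old ones whose coefficients
are entries and minors of `lowerStep u`, all nonnegative. The same holds for `upperStep u` below. -/
theorem IsConvexFrame.mul_lowerStep {M : SL(3, ℝ)} (h : IsConvexFrame M) {u : ℝˣ}
    (hu : 0 < (u : ℝ)) : IsConvexFrame (M * lowerStep u) := by
  obtain ⟨⟨h0, h1, h2⟩, h3, h4, h5⟩ := h
  simp only [IsConvexFrame, Matrix.SpecialLinearGroup.coe_mul, coe_lowerStep]
  refine ⟨⟨?_, ?_, ?_⟩, ?_, ?_, ?_⟩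
  · convert (show 0 < (u : ℝ)⁻¹ * (M 2 0 + M 2 1 + M 2 2) by positivity) using 1
    simp [Matrix.mul_apply, Fin.sum_univ_three]; ring
  · convert (show 0 < (u : ℝ)⁻¹ * M 2 1 + ((u : ℝ)⁻¹ + u ^ 2) * M 2 2 by positivity) using 1
    simp [Matrix.mul_apply, Fin.sum_univ_three]; ring
  · convert (show 0 < (u : ℝ) ^ 2 * M 2 2 by positivity) using 1
    simp [Matrix.mul_apply, Fin.sum_univ_three]; ring
  · convert (show 0 < (u : ℝ)⁻¹ ^ 2 * (M 1 0 * M 2 1 - M 1 1 * M 2 0) +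
        (u : ℝ)⁻¹ * ((u : ℝ)⁻¹ + u ^ 2) * (M 1 0 * M 2 2 - M 1 2 * M 2 0) +
        (u : ℝ)⁻¹ * u ^ 2 * (M 1 1 * M 2 2 - M 1 2 * M 2 1) by positivity) using 1
    simp [Matrix.mul_apply, Fin.sum_univ_three]; ring
  · convert (show 0 < (u : ℝ)⁻¹ * u ^ 2 * (M 1 0 * M 2 2 - M 1 2 * M 2 0) +
        (u : ℝ)⁻¹ * u ^ 2 * (M 1 1 * M 2 2 - M 1 2 * M 2 1) by positivity) using 1
    simp [Matrix.mul_apply, Fin.sum_univ_three]; ring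
  · convert (show 0 < (u : ℝ)⁻¹ * u ^ 2 * (M 1 1 * M 2 2 - M 1 2 * M 2 1) by positivity) using 1
    simp [Matrix.mul_apply, Fin.sum_univ_three]; ring

theorem IsConvexFrame.mul_upperStep {M : SL(3, ℝ)} (h : IsConvexFrame M) {u : ℝˣ}
    (hu : 0 < (u : ℝ)) : IsConvexFrame (M * upperStep u) := by
  obtain ⟨⟨h0, h1, h2⟩, h3, h4, h5⟩ := h
  simp only [IsConvexFrame, Matrix.SpecialLinearGroup.coe_mul, coe_upperStep]
  refine ⟨⟨?_, ?_, ?_⟩, ?_, ?_, ?_⟩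
  · convert (show 0 < (u : ℝ)⁻¹ ^ 2 * M 2 0 by positivity) using 1
    simp [Matrix.mul_apply, Fin.sum_univ_three]; ring
  · convert (show 0 < ((u : ℝ)⁻¹ ^ 2 + u) * M 2 0 + u * M 2 1 by positivity) using 1
    simp [Matrix.mul_apply, Fin.sum_univ_three]; ring
  · convert (show 0 < (u : ℝ) * (M 2 0 + M 2 1 + M 2 2) by positivity) using 1
    simp [Matrix.mul_apply, Fin.sum_univ_three]; ring
  · convert (show 0 < (u : ℝ)⁻¹ ^ 2 * u * (M 1 0 * M 2 1 - M 1 1 * M 2 0) by positivity) using 1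
    simp [Matrix.mul_apply, Fin.sum_univ_three]; ring
  · convert (show 0 < (u : ℝ)⁻¹ ^ 2 * u * ((M 1 0 * M 2 1 - M 1 1 * M 2 0) +
        (M 1 0 * M 2 2 - M 1 2 * M 2 0)) by positivity) using 1
    simp [Matrix.mul_apply, Fin.sum_univ_three]; ring
  · convert (show 0 < (u : ℝ)⁻¹ ^ 2 * u * (M 1 0 * M 2 1 - M 1 1 * M 2 0) +
        ((u : ℝ)⁻¹ ^ 2 + u) * u * (M 1 0 * M 2 2 - M 1 2 * M 2 0) +
        u ^ 2 * (M 1 1 * M 2 2 - M 1 2 * M 2 1) by positivity) using 1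
    simp [Matrix.mul_apply, Fin.sum_univ_three]; ring

/-- The translation fixes the standard flag. On the last two rows it acts by an upper triangular
block with positive diagonal, so the bottom row and the minors are only multiplied by positive
scalars. -/
theorem IsConvexFrame.upperStep_mul {M : SL(3, ℝ)} (h : IsConvexFrame M) {u : ℝˣ}
    (hu : 0 < (u : ℝ)) : IsConvexFrame (upperStep u * M) := by
  obtain ⟨⟨h0, h1, h2⟩, h3, h4, h5⟩ := h
  simp only [IsConvexFrame, Matrix.SpecialLinearGroup.coe_mul, coe_upperStep]
  refine ⟨⟨?_, ?_, ?_⟩, ?_, ?_, ?_⟩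
  · convert (show 0 < (u : ℝ) * M 2 0 by positivity) using 1
    simp [Matrix.mul_apply, Fin.sum_univ_three]
  · convert (show 0 < (u : ℝ) * M 2 1 by positivity) using 1
    simp [Matrix.mul_apply, Fin.sum_univ_three]
  · convert (show 0 < (u : ℝ) * M 2 2 by positivity) using 1
    simp [Matrix.mul_apply, Fin.sum_univ_three]
  · convert (show 0 < (u : ℝ) ^ 2 * (M 1 0 * M 2 1 - M 1 1 * M 2 0) by positivity) using 1
    simp [Matrix.mul_apply, Fin.sum_univ_three]; ring
  · convert (show 0 < (u : ℝ) ^ 2 * (M 1 0 * M 2 2 - M 1 2 * M 2 0) by positivity) using 1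
    simp [Matrix.mul_apply, Fin.sum_univ_three]; ring
  · convert (show 0 < (u : ℝ) ^ 2 * (M 1 1 * M 2 2 - M 1 2 * M 2 1) by positivity) using 1
    simp [Matrix.mul_apply, Fin.sum_univ_three]; ring

theorem IsConvexFrame.upperStep_inv_mul {M : SL(3, ℝ)} (h : IsConvexFrame M) {u : ℝˣ}
    (hu : 0 < (u : ℝ)) : IsConvexFrame ((upperStep u)⁻¹ * M) := by
  obtain ⟨⟨h0, h1, h2⟩, h3, h4, h5⟩ := h
  simp only [IsConvexFrame, Matrix.SpecialLinearGroup.coe_mul, coe_upperStep_inv]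
  refine ⟨⟨?_, ?_, ?_⟩, ?_, ?_, ?_⟩
  · convert (show 0 < (u : ℝ)⁻¹ * M 2 0 by positivity) using 1
    simp [Matrix.mul_apply, Fin.sum_univ_three]
  · convert (show 0 < (u : ℝ)⁻¹ * M 2 1 by positivity) using 1
    simp [Matrix.mul_apply, Fin.sum_univ_three]
  · convert (show 0 < (u : ℝ)⁻¹ * M 2 2 by positivity) using 1
    simp [Matrix.mul_apply, Fin.sum_univ_three]
  · convert (show 0 < (u : ℝ)⁻¹ ^ 2 * (M 1 0 * M 2 1 - M 1 1 * M 2 0) by positivity) using 1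
    simp [Matrix.mul_apply, Fin.sum_univ_three]; ring
  · convert (show 0 < (u : ℝ)⁻¹ ^ 2 * (M 1 0 * M 2 2 - M 1 2 * M 2 0) by positivity) using 1
    simp [Matrix.mul_apply, Fin.sum_univ_three]; ring
  · convert (show 0 < (u : ℝ)⁻¹ ^ 2 * (M 1 1 * M 2 2 - M 1 2 * M 2 1) by positivity) using 1
    simp [Matrix.mul_apply, Fin.sum_univ_three]; ring

/-- The modular transformation is realized on the framings by a convex frame. -/
def HasConvexFrame (A : SL(2, ℤ)) : Prop :=
  ∀ u : ℝˣ, 0 < (u : ℝ) → ∃ (M : SL(3, ℝ)) (v : ℝˣ), 0 < (v : ℝ) ∧ IsConvexFrame M ∧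
    ∀ c, framing u (Cusp.move A c) = act M (framing v c)

theorem HasConvexFrame.upperShear_mul {A : SL(2, ℤ)} (h : HasConvexFrame A) :
    HasConvexFrame (upperShear * A) := by
  intro u hu
  obtain ⟨M, v, hv, hM, hc⟩ := h u⁻¹ (inv_pos_unit hu)
  exact ⟨upperStep u * M, v, hv, hM.upperStep_mul hu, fun c => by
    rw [Cusp.move_mul, framing_upperShear hu, hc, act_mul]⟩

theorem HasConvexFrame.upperShear_inv_mul {A : SL(2, ℤ)} (h : HasConvexFrame A) :
    HasConvexFrame (upperShear⁻¹ * A) := by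
  intro u hu
  obtain ⟨M, v, hv, hM, hc⟩ := h u⁻¹ (inv_pos_unit hu)
  refine ⟨(upperStep u⁻¹)⁻¹ * M, v, hv, hM.upperStep_inv_mul (inv_pos_unit hu), fun c => ?_⟩
  have h1 := framing_upperShear (inv_pos_unit hu) (Cusp.move (upperShear⁻¹ * A) c)
  rw [← Cusp.move_mul, mul_inv_cancel_left, inv_inv, hc] at h1
  rw [act_mul, h1, ← act_mul, inv_mul_cancel, act_one]

theorem HasConvexFrame.mul_upperShear {A : SL(2, ℤ)} (h : HasConvexFrame A) :
    HasConvexFrame (A * upperShear) := by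
  intro u hu
  obtain ⟨M, v, hv, hM, hc⟩ := h u hu
  exact ⟨M * upperStep v, v⁻¹, inv_pos_unit hv, hM.mul_upperStep hv, fun c => by
    rw [Cusp.move_mul, hc, framing_upperShear hv, act_mul]⟩

theorem HasConvexFrame.mul_lowerShear {A : SL(2, ℤ)} (h : HasConvexFrame A) :
    HasConvexFrame (A * lowerShear) := by
  intro u hu
  obtain ⟨M, v, hv, hM, hc⟩ := h u hu
  exact ⟨M * lowerStep v, v⁻¹, inv_pos_unit hv, hM.mul_lowerStep hv, fun c => by
    rw [Cusp.move_mul, hc, framing_lowerShear hv, act_mul]⟩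

theorem hasConvexFrame_upperShear_zpow_mul_lowerShear (k : ℤ) :
    HasConvexFrame (upperShear ^ k * lowerShear) := by
  induction k using Int.induction_on with
  | zero =>
    intro u hu
    exact ⟨lowerStep u, u⁻¹, inv_pos_unit hu, isConvexFrame_lowerStep hu, fun c => by
      rw [zpow_zero, one_mul, framing_lowerShear hu]⟩
  | succ n ih =>
    rw [add_comm, zpow_add, zpow_one, mul_assoc]
    exact ih.upperShear_mul
  | pred n ih =>
    rw [sub_eq_add_neg, add_comm, zpow_add, zpow_neg_one, mul_assoc]
    exact ih.upperShear_inv_mul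

theorem coe_upperShear_zpow (k : ℤ) :
    ((upperShear ^ k : SL(2, ℤ)) : Matrix (Fin 2) (Fin 2) ℤ) = !![1, k; 0, 1] :=
  ModularGroup.coe_T_zpow k

/-- Subtractive Euclidean algorithm on the bottom row: splitting off `T` or `L` on the right
subtracts the smaller entry from the larger one. -/
theorem hasConvexFrame_of_pos {A : SL(2, ℤ)} (h0 : 0 < A 1 0) (h1 : 0 < A 1 1) :
    HasConvexFrame A := by
  obtain ⟨n, hn⟩ : ∃ n : ℕ, A 1 0 + A 1 1 ≤ n := ⟨_, Int.self_le_toNat _⟩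
  induction n generalizing A with
  | zero => push_cast at hn; omega
  | succ n ih =>
    have hdet := A.det_coe
    rw [Matrix.det_fin_two] at hdet
    push_cast at hn
    rcases lt_trichotomy (A 1 0) (A 1 1) with h | h | h
    · have e : ((A * upperShear⁻¹ : SL(2, ℤ)) : Matrix (Fin 2) (Fin 2) ℤ) =
          !![A 0 0, A 0 1 - A 0 0; A 1 0, A 1 1 - A 1 0] := by
        rw [Matrix.SpecialLinearGroup.coe_mul, Matrix.SpecialLinearGroup.coe_inv, coe_upperShear,
          Matrix.adjugate_fin_two_of]
        ext i j
        fin_cases i <;> fin_cases j <;> simp [Matrix.mul_apply, Fin.sum_univ_two] <;> ring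
      have := (ih (A := A * upperShear⁻¹) (by rw [e]; simpa using h0) (by rw [e]; simpa using h)
        (by rw [e]; simp; omega)).mul_upperShear
      rwa [inv_mul_cancel_right] at this
    · have hu : A 1 1 * (A 0 0 - A 0 1) = 1 := by
        linear_combination hdet + A 0 1 * h
      have h11 : A 1 1 = 1 := Int.eq_one_of_mul_eq_one_right h1.le hu
      have h00 : A 0 0 = A 0 1 + 1 := by rw [h11] at hu; linarith
      have e : A = upperShear ^ (A 0 1) * lowerShear := by
        apply Subtype.ext
        rw [Matrix.SpecialLinearGroup.coe_mul, coe_upperShear_zpow, coe_lowerShear]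
        ext i j
        fin_cases i <;> fin_cases j <;> simp [Matrix.mul_apply, Fin.sum_univ_two]
        · rw [h00]; ring
        · rw [h, h11]
        · exact h11
      rw [e]
      exact hasConvexFrame_upperShear_zpow_mul_lowerShear _
    · have e : ((A * lowerShear⁻¹ : SL(2, ℤ)) : Matrix (Fin 2) (Fin 2) ℤ) =
          !![A 0 0 - A 0 1, A 0 1; A 1 0 - A 1 1, A 1 1] := by
        rw [Matrix.SpecialLinearGroup.coe_mul, Matrix.SpecialLinearGroup.coe_inv, coe_lowerShear,
          Matrix.adjugate_fin_two_of]
        ext i j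
        fin_cases i <;> fin_cases j <;> simp [Matrix.mul_apply, Fin.sum_univ_two] <;> ring
      have := (ih (A := A * lowerShear⁻¹) (by rw [e]; simpa using h) (by rw [e]; simpa using h1)
        (by rw [e]; simp; omega)).mul_lowerShear
      rwa [inv_mul_cancel_right] at this

/-- The minors of the last two rows order the points and make the lines nonvertical. Each vertical
gap has numerator reducing to the determinant, hence to `1`, over a product of positive quantities.
-/
theorem IsConvexFrame.convex {M : SL(3, ℝ)} (h : IsConvexFrame M) {F : FullFlag}
    (hF : F.IsFrame ![0, 0, 1] ![0, 1, 0]) : (act M F).Convex (act M std) := by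
  obtain ⟨⟨h0, h1, h2⟩, h3, h4, h5⟩ := h
  have hF' := hF.act M
  have e0 : M.1.mulVec ![0, 0, 1] = ![M 0 2, M 1 2, M 2 2] := by
    ext i; fin_cases i <;> simp [Matrix.mulVec, dotProduct, Fin.sum_univ_three]
  have e1 : M.1.mulVec ![0, 1, 0] = ![M 0 1, M 1 1, M 2 1] := by
    ext i; fin_cases i <;> simp [Matrix.mulVec, dotProduct, Fin.sum_univ_three]
  rw [e0, e1] at hF'
  have h3' : M 1 1 * M 2 0 - M 1 0 * M 2 1 < 0 := by linarith
  have hdet := M.det_coe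
  rw [Matrix.det_fin_three] at hdet
  refine ⟨_, _, _, _, _, _, hF'.isAffine h2.ne' h5.ne',
    (isFrame_act_std M).isAffine h0.ne' h3'.ne, ?_, ?_, ?_⟩
  · rw [div_lt_div_iff₀ h2 h0]; linarith
  · rw [← sub_pos]
    have key : ∀ m, m ≠ 0 → m = M 1 1 * M 2 2 - M 1 2 * M 2 1 →
        M 0 0 / M 2 0 - M 0 2 / M 2 2 - (M 0 1 * M 2 2 - M 0 2 * M 2 1) / m *
          (M 1 0 / M 2 0 - M 1 2 / M 2 2) = 1 / (m * M 2 0) := by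
      intro m hm hmd
      field_simp
      subst hmd
      linear_combination M 2 2 * hdet
    rw [key _ h5.ne' rfl]
    positivity
  · rw [← sub_pos]
    have key : ∀ m, m ≠ 0 → m = M 1 1 * M 2 0 - M 1 0 * M 2 1 →
        (M 0 1 * M 2 0 - M 0 0 * M 2 1) / m * (M 1 0 / M 2 0 - M 1 2 / M 2 2) -
          (M 0 0 / M 2 0 - M 0 2 / M 2 2) = 1 / (-m * M 2 2) := by
      intro m hm hmd
      field_simp
      subst hmd
      linear_combination -M 2 0 * hdet
    rw [key _ h3'.ne rfl, neg_sub]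
    positivity

theorem framing_convex {u : ℝˣ} (hu : 0 < (u : ℝ)) {q r : ℚ} (hqr : q < r) :
    (framing u (q : Cusp)).Convex (framing u (r : Cusp)) := by
  refine Rat.rel_of_lt_of_farey (R := fun q r : ℚ =>
    (framing u (q : Cusp)).Convex (framing u (r : Cusp))) (fun _ _ _ => Convex.trans) ?_ hqr
  intro a b c d hb hd h
  -- The columns are chosen so that `∞` goes to the right endpoint `c / d` and `0` to the left
  -- endpoint `a / b`.
  let A : SL(2, ℤ) := ⟨!![c, a; d, b], by rw [Matrix.det_fin_two_of, h]⟩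
  have hA : (A : Matrix (Fin 2) (Fin 2) ℤ) = !![c, a; d, b] := rfl
  obtain ⟨M, v, hv, hM, hc⟩ := hasConvexFrame_of_pos (A := A) hd hb u hu
  have := hM.convex (isFrame_framing_zero hv)
  rw [← framing_infty hv, ← hc, ← hc, Cusp.move_infty, Cusp.move_coe, hA] at this
  simpa [hd.ne', hb.ne'] using this

/-- Equivariance allows the first cusp to be `∞`; orientation is preserved, so the others become
increasing rationals and convexity applies. -/
theorem isPositiveQuadruple_framing {u : ℝˣ} (hu : 0 < (u : ℝ)) {a b c d : Cusp}
    (h : Cusp.Cyclic a b c d) :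
    IsPositiveQuadruple (framing u a) (framing u b) (framing u c) (framing u d) := by
  obtain ⟨g, rfl⟩ := exists_cuspAct_infty a
  have key : ∀ c, ∃ c', c = cuspAct g c' := fun c =>
    ⟨cuspAct g⁻¹ c, by rw [← cuspAct_mul, mul_inv_cancel, cuspAct_one]⟩
  obtain ⟨b, rfl⟩ := key b
  obtain ⟨c, rfl⟩ := key c
  obtain ⟨d, rfl⟩ := key d
  have hback : ∀ c, Cusp.move (holonomy g⁻¹) (cuspAct g c) = c := fun c => by
    rw [← cuspAct_eq, ← cuspAct_mul, inv_mul_cancel, cuspAct_one]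
  have h1 := Cusp.orient_move_pos (holonomy g⁻¹) h.orient_pos.1
  have h2 := Cusp.orient_move_pos (holonomy g⁻¹) h.orient_pos.2
  simp only [hback] at h1 h2
  obtain ⟨p, q, rfl, rfl, hpq⟩ := Cusp.exists_coe_of_orient_pos h1
  obtain ⟨q', r, hq', rfl, hqr⟩ := Cusp.exists_coe_of_orient_pos h2
  rw [OnePoint.coe_eq_coe] at hq'
  subst hq'
  simp only [framing_cuspAct hu, isPositiveQuadruple_act, framing_infty hu]
  exact isPositiveQuadruple_of_convex (framing_convex hu hpq) (framing_convex hu hqr)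

end Gamma11

/-! ### Fock–Goncharov coordinates of the framing -/

namespace Gamma11

open FullFlag

theorem hasZeroShearsAndTripleRatios_framing {u : ℝˣ} (hu : 0 < (u : ℝ)) :
    HasZeroShearsAndTripleRatios (framing u) ((u : ℝ) ^ 3) ((u : ℝ) ^ 3)⁻¹ := by
  have hu0 := hu.ne'
  have finf : (framing u OnePoint.infty).IsFrame ![1, 0, 0] ![0, 1, 0] :=
    (framing_infty hu).symm ▸ isFrame_std
  have f0 := isFrame_framing_zero hu
  have f1 := isFrame_act_std (rep u δ⁻¹)
  rw [← framing_cuspAct_infty hu, cuspAct_δ_inv_infty, coe_rep_δ_inv] at f1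
  have f1' := isFrame_act_std (rep u γ⁻¹)
  rw [← framing_cuspAct_infty hu, cuspAct_γ_inv_infty, coe_rep_γ_inv] at f1'
  have f2 := isFrame_act_std (rep u γ)
  rw [← framing_cuspAct_infty hu, cuspAct_γ_infty, coe_rep_γ] at f2
  have f2' := isFrame_act_std (rep u δ)
  rw [← framing_cuspAct_infty hu, cuspAct_δ_infty, coe_rep_δ] at f2'
  -- Zero shears amount to both cross ratios being `-1`.
  have hlog : ∀ {p q : ℝ}, p = -1 → q = -1 → (Real.log (-p), Real.log (-q)) = (0, 0) := by
    rintro _ _ rfl rfl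
    simp
  refine ⟨?_, ?_, hlog ?_ ?_, hlog ?_ ?_, hlog ?_ ?_⟩
  · rw [tripleRatio_eq f0 f1 finf]
    simp [wedge3, Matrix.det_fin_three]
    field_simp
    ring
  · rw [tripleRatio_eq finf f1' f0]
    simp [wedge3, Matrix.det_fin_three]
    field_simp
    ring_nf
    rw [← mul_pow, mul_inv_cancel₀ hu0, one_pow]
  · rw [pcrAt_eq finf f1' f0 f1]
    simp [wedge3, Matrix.det_fin_three]
  · rw [pcrAt_eq f0 f1' finf f1]
    simp [wedge3, Matrix.det_fin_three]
  · rw [pcrAt_eq finf f0 f1 f2]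
    simp [wedge3, Matrix.det_fin_three]
    field_simp
    ring
  · rw [pcrAt_eq f1 f0 finf f2]
    simp [wedge3, Matrix.det_fin_three]
    field_simp
    ring
  · rw [pcrAt_eq finf f2' f1' f0]
    simp [wedge3, Matrix.det_fin_three]
    field_simp
    ring
  · rw [pcrAt_eq f1' f2' finf f0]
    simp [wedge3, Matrix.det_fin_three]
    field_simp
    ring_nf
    rw [← mul_pow, mul_inv_cancel₀ hu0, one_pow]

/-! ### Continuity -/

theorem continuous_upperStep : Continuous upperStep := by
  refine Continuous.subtype_mk ?_ _
  refine continuous_matrix fun i j => ?_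
  have h1 : Continuous fun u : ℝˣ => (u : ℝ) := Units.continuous_val
  have h2 : Continuous fun u : ℝˣ => (u : ℝ)⁻¹ := h1.inv₀ fun u => u.ne_zero
  fin_cases i <;> fin_cases j <;> simp [- inv_pow] <;> fun_prop

theorem continuous_lowerStep : Continuous lowerStep := by
  refine Continuous.subtype_mk ?_ _
  refine continuous_matrix fun i j => ?_
  have h1 : Continuous fun u : ℝˣ => (u : ℝ) := Units.continuous_val
  have h2 : Continuous fun u : ℝˣ => (u : ℝ)⁻¹ := h1.inv₀ fun u => u.ne_zero
  fin_cases i <;> fin_cases j <;> simp [- inv_pow] <;> fun_prop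

theorem continuous_rep (g : Gamma11) : Continuous fun u => rep u g := by
  have hT := continuous_upperStep
  have hL := continuous_lowerStep
  have hγ : Continuous fun u => rep u γ := by
    simp only [rep_γ]
    exact hT.mul (hL.comp continuous_inv)
  have hδ : Continuous fun u => rep u δ := by
    simp only [rep_δ]
    exact (hT.comp continuous_inv).inv.mul hL.inv
  induction g using FreeGroup.induction_on with
  | C1 => simpa using continuous_const
  | of i =>
    fin_cases i
    · exact hγ
    · exact hδ
  | inv_of i h =>
    simp only [map_inv]
    exact h.inv
  | mul x y hx hy =>
    simp only [map_mul]
    exact hx.mul hy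

/-- The positive unit with a given logarithm of its cube. -/
noncomputable def cbrtExp (s : ℝ) : ℝˣ := Units.mk0 (Real.exp (s / 3)) (Real.exp_pos _).ne'

theorem coe_cbrtExp (s : ℝ) : (cbrtExp s : ℝ) = Real.exp (s / 3) := rfl

theorem cbrtExp_pos (s : ℝ) : 0 < (cbrtExp s : ℝ) := Real.exp_pos _

theorem cbrtExp_log_pow {x : ℝ} (hx : 0 < x) : (cbrtExp (Real.log x) : ℝ) ^ 3 = x := by
  rw [coe_cbrtExp, ← Real.exp_nat_mul]
  push_cast
  rw [mul_div_cancel₀ _ (by norm_num : (3 : ℝ) ≠ 0), Real.exp_log hx]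

theorem continuous_cbrtExp : Continuous cbrtExp := by
  rw [Units.continuous_iff]
  refine ⟨?_, ?_⟩
  · exact Real.continuous_exp.comp (continuous_id.div_const 3)
  · simp only [Units.val_inv_eq_inv_val, coe_cbrtExp, ← Real.exp_neg]
    exact Real.continuous_exp.comp (continuous_id.div_const 3).neg

/-! ### The family in `PSL(3, ℝ)` -/

/-- The projection of `SL(3, ℝ)` to `PSL(3, ℝ)`. -/
noncomputable def projPSL : SL(3, ℝ) →* PSL(3, ℝ) :=
  QuotientGroup.mk' (Subgroup.center SL(3, ℝ))

theorem liftSL3_projPSL (A : SL(3, ℝ)) : liftSL3 (projPSL A) = A :=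
  (MulEquiv.ofBijective _ mk_SL3_bijective).symm_apply_apply A

/-- The family of positive representations, parametrized by the triple ratio. -/
noncomputable def positiveRep (x : ℝ) : Gamma11 →* PSL(3, ℝ) :=
  projPSL.comp (rep (cbrtExp (Real.log x)))

theorem continuousOn_positiveRep (g : Gamma11) :
    ContinuousOn (fun x => positiveRep x g) (Set.Ioi 0) := by
  have h : Continuous fun s => projPSL (rep (cbrtExp s) g) :=
    QuotientGroup.continuous_mk.comp ((continuous_rep g).comp continuous_cbrtExp)
  exact h.comp_continuousOn (Real.continuousOn_log.mono fun x hx => (Set.mem_Ioi.1 hx).ne')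

theorem isPositiveFraming_framing (x : ℝ) :
    IsPositiveFraming (positiveRep x) (framing (cbrtExp (Real.log x))) := by
  refine ⟨fun g c => ?_, fun a b c d h => isPositiveQuadruple_framing (cbrtExp_pos _) h⟩
  rw [framing_cuspAct (cbrtExp_pos _), flagAct, positiveRep, MonoidHom.comp_apply,
    liftSL3_projPSL]
  rfl

/-! ### Root lengths -/

theorem eval_charpoly_rep_γ (u : ℝˣ) (t : ℂ) :
    ((rep u γ : Matrix (Fin 3) (Fin 3) ℝ).map Complex.ofReal).charpoly.eval t =
      t ^ 3 - 4 * ((u : ℂ) ^ 2 + (u : ℂ)⁻¹) * t ^ 2 + 4 * ((u : ℂ)⁻¹ ^ 2 + u) * t - 1 := by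
  have hu : ((u : ℝ) : ℂ) ≠ 0 := by exact_mod_cast u.ne_zero
  rw [Matrix.eval_charpoly, coe_rep_γ, Matrix.det_fin_three]
  simp
  field_simp
  ring

/-- The polynomial is that of `γ`: the two matrices are conjugate by the diagonal matrix with
entries `1, -1, 1`. -/
theorem eval_charpoly_rep_δ (u : ℝˣ) (t : ℂ) :
    ((rep u δ : Matrix (Fin 3) (Fin 3) ℝ).map Complex.ofReal).charpoly.eval t =
      t ^ 3 - 4 * ((u : ℂ) ^ 2 + (u : ℂ)⁻¹) * t ^ 2 + 4 * ((u : ℂ)⁻¹ ^ 2 + u) * t - 1 := by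
  have hu : ((u : ℝ) : ℂ) ≠ 0 := by exact_mod_cast u.ne_zero
  rw [Matrix.eval_charpoly, coe_rep_δ, Matrix.det_fin_three]
  simp
  field_simp
  ring

theorem rootLength_positiveRep_eq (x : ℝ) :
    rootLength (positiveRep x γ) = rootLength (positiveRep x δ) := by
  have h := Polynomial.funext fun t : ℂ =>
    (eval_charpoly_rep_γ (cbrtExp (Real.log x)) t).trans
      (eval_charpoly_rep_δ (cbrtExp (Real.log x)) t).symm
  simp only [rootLength, eigenvalueModuli, positiveRep, MonoidHom.comp_apply, liftSL3_projPSL, h]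

/-- The first root length of a matrix with distinct positive eigenvalues. -/
theorem rootLength_projPSL {A : SL(3, ℝ)} {a b c : ℝ} (hab : b < a) (hbc : c < b) (hc : 0 < c)
    (h : ∀ t ∈ ({a, b, c} : Set ℝ),
      ((A : Matrix (Fin 3) (Fin 3) ℝ).map Complex.ofReal).charpoly.eval (t : ℂ) = 0) :
    rootLength (projPSL A) = Real.log (a / b) := by
  set p := ((A : Matrix (Fin 3) (Fin 3) ℝ).map Complex.ofReal).charpoly with hp
  have hmonic : p.Monic := Matrix.charpoly_monic _
  have hdeg : p.natDegree = 3 := by simp [hp, Matrix.charpoly_natDegree_eq_dim]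
  -- Three distinct roots of a cubic are all its roots, each simple.
  have hle : (([a, b, c].map Complex.ofReal : List ℂ) : Multiset ℂ) ≤ p.roots := by
    rw [Multiset.le_iff_subset]
    · intro z hz
      rw [Polynomial.mem_roots hmonic.ne_zero]
      obtain ⟨t, ht, rfl⟩ := List.mem_map.1 (Multiset.mem_coe.1 hz)
      exact h t (by simpa using ht)
    · rw [Multiset.coe_nodup]
      refine List.Nodup.map Complex.ofReal_injective ?_
      simp [hab.ne', hbc.ne', (hbc.trans hab).ne']
  have hroots : (([a, b, c].map Complex.ofReal : List ℂ) : Multiset ℂ) = p.roots := by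
    refine Multiset.eq_of_le_of_card_le hle ?_
    simpa [hdeg] using p.card_roots'
  have hlist : eigenvalueModuli (projPSL A) = [a, b, c] := by
    rw [eigenvalueModuli, liftSL3_projPSL, ← hp, ← hroots]
    have hb := hc.trans hbc
    have ha := hb.trans hab
    have e : Multiset.map (fun z : ℂ => ‖z‖)
        (([a, b, c].map Complex.ofReal : List ℂ) : Multiset ℂ) = ([a, b, c] : List ℝ) := by
      simp [abs_of_pos, ha, hb, hc]
    rw [e, Multiset.coe_sort]
    refine List.mergeSort_of_pairwise ?_
    simp [hab.le, hbc.le, (hbc.trans hab).le]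
  simp [rootLength, hlist]

theorem rootLength_positiveRep_γ {x ε : ℝ} (hε : 0 < ε) (hε1 : ε < 1) (hx : 0 < x)
    (hxε : 25 * x < ε ^ 2) :
    0 ≤ rootLength (positiveRep x γ) ∧ rootLength (positiveRep x γ) ≤ 2 * ε := by
  -- Up to a power of `u`, this is the characteristic polynomial at `u⁻¹ * t`, with `u ^ 3 = x`. The
  -- common factor `u⁻¹` cancels in the ratio of eigenvalues.
  let f : ℝ → ℝ := fun t => t * (t - 2) ^ 2 - x * (2 * t - 1) ^ 2
  have hf : Continuous f := by fun_prop
  have f0 : f 0 < 0 := by simp only [f]; linarith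
  have f2 : f 2 < 0 := by simp only [f]; linarith
  -- At `2 ± ε` the first term of `f` exceeds `ε²`, while `(2 t - 1)²` is below `25`; hence the
  -- hypothesis `25 * x < ε ^ 2`. The sign changes give roots `c < 2 - ε < b < 2 < a < 2 + ε`.
  have f1 : 0 < f (2 - ε) := by
    simp only [f]
    nlinarith [mul_pos hx hε, mul_pos hε hε, mul_pos (mul_pos hε hε) (sub_pos.2 hε1)]
  have f3 : 0 < f (2 + ε) := by
    simp only [f]
    nlinarith [mul_pos hx hε, mul_pos hε hε, mul_pos (mul_pos hε hx) (sub_pos.2 hε1),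
      mul_pos hx (sub_pos.2 hε1), mul_pos (mul_pos hε hε) hε]
  obtain ⟨c, hc, fc⟩ := intermediate_value_Ioo (by linarith) hf.continuousOn ⟨f0, f1⟩
  obtain ⟨b, hb, fb⟩ := intermediate_value_Ioo' (by linarith) hf.continuousOn ⟨f2, f1⟩
  obtain ⟨a, ha, fa⟩ := intermediate_value_Ioo (by linarith) hf.continuousOn ⟨f2, f3⟩
  set u := cbrtExp (Real.log x) with hudef
  have hu : 0 < (u : ℝ) := cbrtExp_pos _
  have hux : (u : ℝ) ^ 3 = x := cbrtExp_log_pow hx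
  have hw : 0 < (u : ℝ)⁻¹ := inv_pos.2 hu
  have root : ∀ t : ℝ, f t = 0 →
      ((rep u γ : Matrix (Fin 3) (Fin 3) ℝ).map Complex.ofReal).charpoly.eval
        (((u : ℝ)⁻¹ * t : ℝ) : ℂ) = 0 := by
    intro t ht
    rw [eval_charpoly_rep_γ]
    have : ((u : ℝ)⁻¹ * t) ^ 3 - 4 * ((u : ℝ) ^ 2 + (u : ℝ)⁻¹) * ((u : ℝ)⁻¹ * t) ^ 2 +
        4 * ((u : ℝ)⁻¹ ^ 2 + u) * ((u : ℝ)⁻¹ * t) - 1 = 0 := by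
      simp only [f, ← hux] at ht
      field_simp
      linear_combination ht
    exact_mod_cast this
  have hlen : rootLength (positiveRep x γ) = Real.log (((u : ℝ)⁻¹ * a) / ((u : ℝ)⁻¹ * b)) := by
    refine rootLength_projPSL (c := (u : ℝ)⁻¹ * c)
      (mul_lt_mul_of_pos_left (hb.2.trans ha.1) hw) (mul_lt_mul_of_pos_left (hc.2.trans hb.1) hw)
      (mul_pos hw hc.1) ?_
    rintro t (rfl | rfl | rfl)
    · exact root a fa
    · exact root b fb
    · exact root c fc
  have hb0 : 0 < b := by linarith [hb.1]
  rw [hlen, mul_div_mul_left _ _ hw.ne']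
  constructor
  · exact Real.log_nonneg ((one_le_div hb0).2 (hb.2.trans ha.1).le)
  -- `log (a / b) ≤ a / b - 1`, which is less than `2 ε / (2 - ε)`, and `2 - ε > 1`.
  · have h1 := Real.log_le_sub_one_of_pos (div_pos (by linarith [ha.1] : 0 < a) hb0)
    refine h1.trans ?_
    rw [sub_le_iff_le_add, div_le_iff₀ hb0]
    nlinarith [ha.2, hb.1]

theorem tendsto_rootLength_positiveRep_γ :
    Tendsto (fun x => rootLength (positiveRep x γ)) (𝓝[>] (0 : ℝ)) (𝓝 0) := by
  rw [Metric.tendsto_nhds]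
  intro η hη
  obtain ⟨ε, hε, hε1, hεη⟩ : ∃ ε : ℝ, 0 < ε ∧ ε < 1 ∧ 2 * ε < η :=
    ⟨min (1 / 2) (η / 4), by positivity, by linarith [min_le_left (1 / 2) (η / 4)],
      by linarith [min_le_right (1 / 2) (η / 4)]⟩
  have hpos : 0 < ε ^ 2 / 25 := by positivity
  filter_upwards [Ioo_mem_nhdsGT hpos] with x hx
  have h := rootLength_positiveRep_γ hε hε1 hx.1 (by linarith [hx.2])
  rw [Real.dist_eq, sub_zero, abs_of_nonneg h.1]
  linarith [h.2]

end Gamma11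

/-- A one-parameter family of positive representations of the fundamental group of the
once-punctured torus for which the first root length of both side pairings tends to zero. -/
theorem theorem1p7 :
    ∃ ρ : ℝ → (Gamma11 →* PSL(3, ℝ)),
      (∀ g : Gamma11, ContinuousOn (fun x => ρ x g) (Set.Ioi 0)) ∧
      (∀ x : ℝ, 0 < x → ∃ ξ : Cusp → FullFlag,
        IsPositiveFraming (ρ x) ξ ∧ HasZeroShearsAndTripleRatios ξ x x⁻¹) ∧
      (∀ x : ℝ, 0 < x → rootLength (ρ x Gamma11.γ) = rootLength (ρ x Gamma11.δ)) ∧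
      Tendsto (fun x => rootLength (ρ x Gamma11.γ)) (𝓝[>] (0 : ℝ)) (𝓝 0) := by
  refine ⟨Gamma11.positiveRep, Gamma11.continuousOn_positiveRep, fun x hx => ?_,
    fun x _ => Gamma11.rootLength_positiveRep_eq x, Gamma11.tendsto_rootLength_positiveRep_γ⟩
  refine ⟨_, Gamma11.isPositiveFraming_framing x, ?_⟩
  have := Gamma11.hasZeroShearsAndTripleRatios_framing (Gamma11.cbrtExp_pos (Real.log x))
  rwa [Gamma11.cbrtExp_log_pow hx] at this
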